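/- **Signatures and models.** A signature $\Sigma=(S,F\supseteq M,L)$ consists of a set $S$ of sorts, sets $F_{w,s}$ ($w\in S^*$, $s\in S$) of function symbols, subsets $M_{w,s}\subseteq F_{w,s}$ of monotonic symbols, and a set $L$ of labels. A signature morphism maps sorts, function symbols (respecting arities and sorts, and preserving $M$) and labels. A $\Sigma$-model $\mathfrak A$ is a many-sorted $(S,F)$-algebra whose carriers may be empty, together with relations $\lambda^{\mathfrak A}_s\subseteq\mathfrak A_s\times\mathfrak A_s$ ($\lambda\in L$, $s\in S$) such that, for each $\sigma\in M$, replacing one argument $a_k$ of $\sigma^{\mathfrak A}$ by $b$ with $(a_k,b)\in\lambda^{\mathfrak A}$ yields a pair of values in $\lambda^{\mathfrak A}$. **Sentences.** Actions: $\mathfrak a::=\lambda\mid \mathfrak a;\mathfrak a\mid\mathfrak a\cup\mathfrak a\mid\mathfrak a^*$, interpreted as composition, union, and reflexive-transitive closure. Sentences: $t_1=t_2$ and $t_1\stackrel{\mathfrak a}\Rightarrow t_2$ (ground terms of the same sort), $\neg\varphi$, $\bigvee\Phi$ ($\Phi$ a finite family of sentences; $\bot:=\bigvee\emptyset$), and $\exists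 X\,\varphi$, where $X$ is a finite, possibly empty, set of sorted variables with pairwise distinct names $v_i$, $i<\omega$, and $\varphi$ is a sentence over $\Sigma[X]$, which is $\Sigma$ with the elements of $X$ added as new constants (never identified with existing symbols). A morphism $\chi$ translates sentences symbol by symbol, with $\chi(\exists X\,\varphi)=\exists X'\,\chi'(\varphi)$, where $X'$ has the same names as $X$, with the sorts translated by $\chi$. Satisfaction is the usual one; $\mathfrak A\models\exists X\,\varphi$ iff some expansion of $\mathfrak A$ to $\Sigma[X]$ satisfies $\varphi$. $\Gamma\models_\Sigma\Phi$ means that every $\Sigma$-model of $\Gamma$ satisfies every sentence in $\Phi$. **Entailment.** The dynamic entailment relation is the least family of relations $\vdash_\Sigma$ between sets of $\Sigma$-sentences, indexed by all signatures, closed under the following rules. Here $\Gamma\vdash\varphi$ means $\Gamma\vdash\{\varphi\}$; $\mathfrak a^0$ is equality, that is, $t_1\stackrel{\mathfrak a^0}\Rightarrow t_2$ is $t_1=t_2$, and $\mathfrak a^1=\mathfrak a$, $\mathfrak a^{n+1}=\mathfrak a;\mathfrak a^n$ for $n\ge1$; $\Sigma$-sentences and $\Sigma$-terms are translated along $\Sigma\to\Sigma[X]$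 where needed. * Structural rules: $\Gamma\vdash\Phi$ if $\Phi\subseteq\Gamma$; transitivity; $\Gamma\vdash\Phi$ if $\Gamma\vdash\varphi$ for all $\varphi\in\Phi$; if $\Gamma\vdash_\Sigma\Phi$, then $\chi(\Gamma)\vdash_{\Sigma'}\chi(\Phi)$ for every $\chi:\Sigma\to\Sigma'$. * Atoms: reflexivity, symmetry and transitivity of $=$; congruence of $=$ for function symbols; if $\Gamma\vdash t_1=t_1'$, $\Gamma\vdash t_2=t_2'$ and $\Gamma\vdash t_1\stackrel{\lambda}\Rightarrow t_2$, then $\Gamma\vdash t_1'\stackrel{\lambda}\Rightarrow t_2'$; if $f\in M$ and $\Gamma\vdash t_j\stackrel{\lambda}\Rightarrow u_j$, then $\Gamma\vdash f(t_1,\dots,t_j,\dots,t_n)\stackrel{\lambda}\Rightarrow f(t_1,\dots,u_j,\dots,t_n)$. * $\mathrm{Comp}_I$: from $\Gamma\vdash t_1\stackrel{\mathfrak a_1}\Rightarrow t$ and $\Gamma\vdash t\stackrel{\mathfrak a_2}\Rightarrow t_2$ infer $\Gamma\vdash t_1\stackrel{\mathfrak a_1;\mathfrak a_2}\Rightarrow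 t_2$. $\mathrm{Comp}_E$: from $\Gamma\vdash_\Sigma t_1\stackrel{\mathfrak a_1;\mathfrak a_2}\Rightarrow t_2$ and $\Gamma\cup\{t_1\stackrel{\mathfrak a_1}\Rightarrow x,\ x\stackrel{\mathfrak a_2}\Rightarrow t_2\}\vdash_{\Sigma[x]}\varphi$, with $x$ a variable of the sort of $t_1$, infer $\Gamma\vdash_\Sigma\varphi$. * $\mathrm{Union}_I$: from $\Gamma\vdash t_1\stackrel{\mathfrak a_i}\Rightarrow t_2$ for $i=1$ or $i=2$ infer $\Gamma\vdash t_1\stackrel{\mathfrak a_1\cup\mathfrak a_2}\Rightarrow t_2$. $\mathrm{Union}_E$: from $\Gamma\vdash t_1\stackrel{\mathfrak a_1\cup\mathfrak a_2}\Rightarrow t_2$ and $\Gamma\cup\{t_1\stackrel{\mathfrak a_i}\Rightarrow t_2\}\vdash\varphi$ for $i=1,2$ infer $\Gamma\vdash\varphi$. * $\mathrm{Star}_I$: from $\Gamma\vdash t_1\stackrel{\mathfrak a^n}\Rightarrow t_2$ for some $n\in\omega$ infer $\Gamma\vdash t_1\stackrel{\mathfrak a^*}\Rightarrow t_2$. $\mathrm{Star}_E$: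 from $\Gamma\vdash t_1\stackrel{\mathfrak a^*}\Rightarrow t_2$ and $\Gamma\cup\{t_1\stackrel{\mathfrak a^n}\Rightarrow t_2\}\vdash\varphi$ for all $n\in\omega$ infer $\Gamma\vdash\varphi$. * Boolean rules: from $\Gamma\vdash\neg\neg\varphi$ infer $\Gamma\vdash\varphi$; from $\Gamma\vdash\bot$ infer $\Gamma\vdash\varphi$; from $\Gamma\cup\{\varphi\}\vdash\bot$ infer $\Gamma\vdash\neg\varphi$, and conversely; from $\Gamma\vdash\varphi$ with $\varphi\in\Phi$ infer $\Gamma\vdash\bigvee\Phi$; from $\Gamma\vdash\bigvee\Phi$ and $\Gamma\cup\{\varphi\}\vdash\gamma$ for all $\varphi\in\Phi$ infer $\Gamma\vdash\gamma$. * Quantifier rules: from $\Gamma\cup\{\varphi\}\vdash_{\Sigma[X]}\gamma$, with $\Gamma,\gamma$ over $\Sigma$, infer $\Gamma\cup\{\exists X\,\varphi\}\vdash_\Sigma\gamma$, and conversely; from $\Gamma\vdash_\Sigma\theta(\varphi)$ for a substitution $\theta:X\to T_\Sigma$ of ground $\Sigma$-terms for the variables in $X$ infer $\Gamma\vdash_\Sigma\exists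 X\,\varphi$. **Theorem (Completeness).** Let $\Sigma$ be a signature with at most countably many sorts, function symbols and labels. For every set $\Gamma$ of $\Sigma$-sentences and every $\Sigma$-sentence $\varphi$, $$\Gamma\vdash_\Sigma\varphi\quad\text{iff}\quad\Gamma\models_\Sigma\varphi .$$ -/

import Mathlib

universe u

namespace TA

/-- A signature `(S, F ⊇ M, L)`: sorts, function symbols `F n w s` of arity `w = w₀ ⋯ wₙ₋₁` (a word of
sorts of length `n`) and sort `s`, the subset of monotonic ones, and transition labels. -/
structure Signature where
  S : Type u
  F : (n : ℕ) → (Fin n → S) → S → Type u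
  M : (n : ℕ) → (w : Fin n → S) → (s : S) → Set (F n w s)
  L : Type u

/-- A signature is (at most) countable if it has at most countably many sorts, function symbols and
labels altogether. -/
def Signature.IsCountable (Sg : Signature.{u}) : Prop :=
  Countable Sg.S ∧ Countable (Σ (n : ℕ) (w : Fin n → Sg.S) (s : Sg.S), Sg.F n w s) ∧ Countable Sg.L

/-- A finite set of sorted variables in which distinct variables have distinct names: a finite set
of names (the name `vᵢ` is the number `i`), each with a sort. -/
structure VarSet (S : Type u) where
  names : Finset ℕ
  sort : {i : ℕ // i ∈ names} → S

/-- Renaming the sorts of the variables, keeping their names. -/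
abbrev VarSet.map {S S' : Type u} (X : VarSet S) (f : S → S') : VarSet S' where
  names := X.names
  sort := fun x => f (X.sort x)

/-- The set whose only variable has name `i` and sort `s`. -/
abbrev VarSet.single {S : Type u} (i : ℕ) (s : S) : VarSet S where
  names := {i}
  sort := fun _ => s

/-- The function symbols of `Σ[X]`: those of `Σ`, and the variables in `X` as new constants. -/
inductive ExtOp (Sg : Signature.{u}) (X : VarSet Sg.S) :
    (n : ℕ) → (Fin n → Sg.S) → Sg.S → Type u
  | old {n : ℕ} {w : Fin n → Sg.S} {s : Sg.S} (f : Sg.F n w s) : ExtOp Sg X n w s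
  | var (w : Fin 0 → Sg.S) (x : {i : ℕ // i ∈ X.names}) : ExtOp Sg X 0 w (X.sort x)

/-- The signature `Σ[X]`. -/
abbrev Signature.ext (Sg : Signature.{u}) (X : VarSet Sg.S) : Signature.{u} where
  S := Sg.S
  F := ExtOp Sg X
  M := fun n w s => {g | ∃ f ∈ Sg.M n w s, g = ExtOp.old f}
  L := Sg.L

/-- Ground terms. -/
inductive Term (Sg : Signature.{u}) : Sg.S → Type u
  | app {n : ℕ} {w : Fin n → Sg.S} {s : Sg.S} (f : Sg.F n w s)
      (ts : (i : Fin n) → Term Sg (w i)) : Term Sg s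

/-- Actions over a set of labels. -/
inductive Action (L : Type u) : Type u
  | lab (l : L) : Action L
  | comp (a b : Action L) : Action L
  | union (a b : Action L) : Action L
  | star (a : Action L) : Action L

def Action.map {L L' : Type u} (f : L → L') : Action L → Action L'
  | .lab l => .lab (f l)
  | .comp a b => .comp (a.map f) (b.map f)
  | .union a b => .union (a.map f) (b.map f)
  | .star a => .star (a.map f)

/-- `a.succPow n` is the power `aⁿ⁺¹ = a ; (a ; ⋯ ; a)`. -/
def Action.succPow {L : Type u} (a : Action L) : ℕ → Action L
  | 0 => a
  | n + 1 => .comp a (a.succPow n)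

/-- Sentences: equations, transitions, negations, finite disjunctions, and existential
quantifications over finite sets of variables, whose bodies are `Σ[X]`-sentences. -/
inductive Sen : Signature.{u} → Type (u + 1)
  | eq {Sg : Signature.{u}} {s : Sg.S} (t₁ t₂ : Term Sg s) : Sen Sg
  | trans {Sg : Signature.{u}} {s : Sg.S} (a : Action Sg.L) (t₁ t₂ : Term Sg s) : Sen Sg
  | neg {Sg : Signature.{u}} (φ : Sen Sg) : Sen Sg
  | disj {Sg : Signature.{u}} {n : ℕ} (Φ : Fin n → Sen Sg) : Sen Sg
  | ex {Sg : Signature.{u}} (X : VarSet Sg.S) (φ : Sen (Sg.ext X)) : Sen Sg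

/-- Falsity is the empty disjunction. -/
def Sen.bot {Sg : Signature.{u}} : Sen Sg := .disj (n := 0) Fin.elim0

/-- The sentence `t₁ ⇒[aⁿ] t₂`; for `n = 0` it is the equation `t₁ = t₂`. -/
def Sen.transPow {Sg : Signature.{u}} {s : Sg.S} (a : Action Sg.L) (n : ℕ) (t₁ t₂ : Term Sg s) :
    Sen Sg :=
  match n with
  | 0 => .eq t₁ t₂
  | n + 1 => .trans (a.succPow n) t₁ t₂

/-! ### Signature morphisms, substitutions, and how they act on sentences -/

/-- Signature morphisms. -/
structure Hom (Sg Sg' : Signature.{u}) where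
  sort : Sg.S → Sg'.S
  op : {n : ℕ} → {w : Fin n → Sg.S} → {s : Sg.S} → Sg.F n w s → Sg'.F n (fun i => sort (w i)) (sort s)
  mono : ∀ {n : ℕ} {w : Fin n → Sg.S} {s : Sg.S} (f : Sg.F n w s),
    f ∈ Sg.M n w s → op f ∈ Sg'.M n (fun i => sort (w i)) (sort s)
  lab : Sg.L → Sg'.L

/-- What a function symbol can be replaced by: a symbol of the same arity and sort or, in the case
of a constant, a term. -/
inductive Image (Sg : Signature.{u}) : (n : ℕ) → (Fin n → Sg.S) → Sg.S → Type u
  | sym {n : ℕ} {w : Fin n → Sg.S} {s : Sg.S} (f : Sg.F n w s) : Image Sg n w s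
  | tm {w : Fin 0 → Sg.S} {s : Sg.S} (t : Term Sg s) : Image Sg 0 w s

def Image.apply {Sg : Signature.{u}} {n : ℕ} {w : Fin n → Sg.S} {s : Sg.S} :
    Image Sg n w s → ((i : Fin n) → Term Sg (w i)) → Term Sg s
  | .sym f, ts => .app f ts
  | .tm t, _ => t

/-- A common generalization of signature morphisms `Σ → Σ'` and of substitutions `X → T_Σ` (as maps
from `Σ[X]` to `Σ`), used only to define the action of both on sentences at once. -/
structure Repl (Sg Sg' : Signature.{u}) where
  sort : Sg.S → Sg'.S
  op : {n : ℕ} → {w : Fin n → Sg.S} → {s : Sg.S} → Sg.F n w s →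
    Image Sg' n (fun i => sort (w i)) (sort s)
  lab : Sg.L → Sg'.L

abbrev Hom.toRepl {Sg Sg' : Signature.{u}} (χ : Hom Sg Sg') : Repl Sg Sg' where
  sort := χ.sort
  op := fun f => .sym (χ.op f)
  lab := χ.lab

/-- The inclusion `Σ → Σ[X]`. -/
abbrev incl (Sg : Signature.{u}) (X : VarSet Sg.S) : Hom Sg (Sg.ext X) where
  sort := fun s => s
  op := fun f => ExtOp.old f
  mono := fun f hf => ⟨f, hf, rfl⟩
  lab := fun l => l

/-- A substitution `θ : X → T_Σ`, as a replacement of the symbols of `Σ[X]`. -/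
abbrev substRepl {Sg : Signature.{u}} {X : VarSet Sg.S}
    (θ : (x : {i : ℕ // i ∈ X.names}) → Term Sg (X.sort x)) : Repl (Sg.ext X) Sg where
  sort := fun s => s
  op := fun f => match f with
    | .old f => .sym f
    | .var _ x => .tm (θ x)
  lab := fun l => l

def Term.map {Sg Sg' : Signature.{u}} (ρ : Repl Sg Sg') :
    {s : Sg.S} → Term Sg s → Term Sg' (ρ.sort s)
  | _, .app f ts => (ρ.op f).apply (fun i => (ts i).map ρ)

/-- The inclusion `Σ → Σ[X]` acting on the replacements of symbols. -/
def Image.lift {Sg : Signature.{u}} (X : VarSet Sg.S) {n : ℕ} {w : Fin n → Sg.S} {s : Sg.S} :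
    Image Sg n w s → Image (Sg.ext X) n w s
  | .sym f => .sym (Sg := Sg.ext X) (ExtOp.old f)
  | .tm t => .tm (Sg := Sg.ext X) (Term.map (incl Sg X).toRepl t)

/-- The extension `Σ[X] → Σ'[X']` which maps every variable in `X` to the one of the same name in
`X'`. -/
abbrev Repl.lift {Sg Sg' : Signature.{u}} (ρ : Repl Sg Sg') (X : VarSet Sg.S) :
    Repl (Sg.ext X) (Sg'.ext (X.map ρ.sort)) where
  sort := ρ.sort
  op := fun f => match f with
    | .old f => (ρ.op f).lift (X.map ρ.sort)
    | .var w x => .sym (Sg := Sg'.ext (X.map ρ.sort))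
        (ExtOp.var (X := X.map ρ.sort) (fun i => ρ.sort (w i)) x)
  lab := ρ.lab

def Sen.map : {Sg Sg' : Signature.{u}} → Repl Sg Sg' → Sen Sg → Sen Sg'
  | _, _, ρ, .eq t₁ t₂ => .eq (t₁.map ρ) (t₂.map ρ)
  | _, _, ρ, .trans a t₁ t₂ => .trans (a.map ρ.lab) (t₁.map ρ) (t₂.map ρ)
  | _, _, ρ, .neg φ => .neg (φ.map ρ)
  | _, _, ρ, .disj Φ => .disj (fun i => (Φ i).map ρ)
  | _, _, ρ, .ex X φ => .ex (X.map ρ.sort) (φ.map (ρ.lift X))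

/-- The translation `χ(φ)` of a sentence along a signature morphism. -/
def Sen.translate {Sg Sg' : Signature.{u}} (χ : Hom Sg Sg') (φ : Sen Sg) : Sen Sg' :=
  φ.map χ.toRepl

/-- The instance `θ(φ)` of a `Σ[X]`-sentence under a substitution. -/
def Sen.subst {Sg : Signature.{u}} {X : VarSet Sg.S}
    (θ : (x : {i : ℕ // i ∈ X.names}) → Term Sg (X.sort x)) (φ : Sen (Sg.ext X)) : Sen Sg :=
  φ.map (substRepl θ)

/-- A `Σ`-sentence, `Σ`-term as a `Σ[X]`-sentence, `Σ[X]`-term. -/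
def Sen.wk {Sg : Signature.{u}} (X : VarSet Sg.S) (φ : Sen Sg) : Sen (Sg.ext X) :=
  φ.translate (incl Sg X)

def Term.wk {Sg : Signature.{u}} (X : VarSet Sg.S) {s : Sg.S} (t : Term Sg s) :
    Term (Sg.ext X) (show (Sg.ext X).S from s) :=
  t.map (incl Sg X).toRepl

/-- The variable `x` as a `Σ[X]`-term. -/
def Term.var {Sg : Signature.{u}} {X : VarSet Sg.S} (x : {i : ℕ // i ∈ X.names}) :
    Term (Sg.ext X) (show (Sg.ext X).S from X.sort x) :=
  .app (Sg := Sg.ext X) (ExtOp.var Fin.elim0 x) (fun i => i.elim0)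

/-! ### Models and satisfaction -/

/-- Models; carriers may be empty. -/
structure Model (Sg : Signature.{u}) where
  carrier : Sg.S → Type u
  op : {n : ℕ} → {w : Fin n → Sg.S} → {s : Sg.S} → Sg.F n w s →
    ((i : Fin n) → carrier (w i)) → carrier s
  rel : Sg.L → (s : Sg.S) → carrier s → carrier s → Prop
  monotone : ∀ {n : ℕ} {w : Fin n → Sg.S} {s : Sg.S} (f : Sg.F n w s), f ∈ Sg.M n w s →
    ∀ (l : Sg.L) (a : (i : Fin n) → carrier (w i)) (k : Fin n) (b : carrier (w k)),
      rel l (w k) (a k) b → rel l s (op f a) (op f (Function.update a k b))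

/-- The interpretation of a term. -/
def Model.eval {Sg : Signature.{u}} (A : Model Sg) : {s : Sg.S} → Term Sg s → A.carrier s
  | _, .app f ts => A.op f (fun i => A.eval (ts i))

/-- The interpretation of an action. -/
def Model.act {Sg : Signature.{u}} (A : Model Sg) :
    Action Sg.L → (s : Sg.S) → A.carrier s → A.carrier s → Prop
  | .lab l, s => A.rel l s
  | .comp a b, s => Relation.Comp (A.act a s) (A.act b s)
  | .union a b, s => fun x y => A.act a s x y ∨ A.act b s x y
  | .star a, s => Relation.ReflTransGen (A.act a s)

/-- The expansion of `A` to `Σ[X]` given by a valuation `g : X → A`. -/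
abbrev Model.expand {Sg : Signature.{u}} (A : Model Sg) {X : VarSet Sg.S}
    (g : (x : {i : ℕ // i ∈ X.names}) → A.carrier (X.sort x)) : Model (Sg.ext X) where
  carrier := A.carrier
  op := fun f => match f with
    | .old f => A.op f
    | .var _ x => fun _ => g x
  rel := A.rel
  monotone := by
    rintro n w s _ ⟨f, hf, rfl⟩ l a k b h
    exact A.monotone f hf l a k b h

/-- The satisfaction relation. -/
def Sat : {Sg : Signature.{u}} → Model Sg → Sen Sg → Prop
  | _, A, .eq t₁ t₂ => A.eval t₁ = A.eval t₂
  | _, A, .trans (s := s) a t₁ t₂ => A.act a s (A.eval t₁) (A.eval t₂)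
  | _, A, .neg φ => ¬ Sat A φ
  | _, A, .disj Φ => ∃ i, Sat A (Φ i)
  | _, A, .ex X φ =>
      ∃ g : (x : {i : ℕ // i ∈ X.names}) → A.carrier (X.sort x), Sat (A.expand g) φ

/-- `Γ ⊨ Φ`. -/
def SemEntails (Sg : Signature.{u}) (Γ Φ : Set (Sen Sg)) : Prop :=
  ∀ A : Model Sg, (∀ γ ∈ Γ, Sat A γ) → ∀ φ ∈ Φ, Sat A φ

/-! ### The dynamic entailment relation -/

/-- The dynamic entailment relation `Γ ⊢_Σ Φ`: the least family of relations, indexed by all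
signatures, that is closed under the rules below. -/
inductive Entails : (Sg : Signature.{u}) → Set (Sen Sg) → Set (Sen Sg) → Prop
  -- structural rules
  | monotonicity {Sg : Signature.{u}} {Γ Φ : Set (Sen Sg)} (h : Φ ⊆ Γ) : Entails Sg Γ Φ
  | transitivity {Sg : Signature.{u}} {Γ Φ Ψ : Set (Sen Sg)} :
      Entails Sg Γ Φ → Entails Sg Φ Ψ → Entails Sg Γ Ψ
  | union {Sg : Signature.{u}} {Γ Φ : Set (Sen Sg)} :
      (∀ φ ∈ Φ, Entails Sg Γ {φ}) → Entails Sg Γ Φ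
  | translation {Sg Sg' : Signature.{u}} (χ : Hom Sg Sg') {Γ Φ : Set (Sen Sg)} :
      Entails Sg Γ Φ → Entails Sg' (Sen.translate χ '' Γ) (Sen.translate χ '' Φ)
  -- basic rules
  | refl {Sg : Signature.{u}} {Γ : Set (Sen Sg)} {s : Sg.S} (t : Term Sg s) :
      Entails Sg Γ {.eq t t}
  | symm {Sg : Signature.{u}} {Γ : Set (Sen Sg)} {s : Sg.S} {t₁ t₂ : Term Sg s} :
      Entails Sg Γ {.eq t₁ t₂} → Entails Sg Γ {.eq t₂ t₁}
  | eqTrans {Sg : Signature.{u}} {Γ : Set (Sen Sg)} {s : Sg.S} {t₁ t₂ t₃ : Term Sg s} :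
      Entails Sg Γ {.eq t₁ t₂} → Entails Sg Γ {.eq t₂ t₃} → Entails Sg Γ {.eq t₁ t₃}
  | congr {Sg : Signature.{u}} {Γ : Set (Sen Sg)} {n : ℕ} {w : Fin n → Sg.S} {s : Sg.S}
      (f : Sg.F n w s) {ts us : (i : Fin n) → Term Sg (w i)} :
      (∀ i, Entails Sg Γ {.eq (ts i) (us i)}) → Entails Sg Γ {.eq (.app f ts) (.app f us)}
  | predCongr {Sg : Signature.{u}} {Γ : Set (Sen Sg)} {s : Sg.S} (l : Sg.L)
      {t₁ t₂ u₁ u₂ : Term Sg s} :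
      Entails Sg Γ {.eq t₁ u₁} → Entails Sg Γ {.eq t₂ u₂} →
      Entails Sg Γ {.trans (.lab l) t₁ t₂} → Entails Sg Γ {.trans (.lab l) u₁ u₂}
  | mono {Sg : Signature.{u}} {Γ : Set (Sen Sg)} {n : ℕ} {w : Fin n → Sg.S} {s : Sg.S}
      (f : Sg.F n w s) (hf : f ∈ Sg.M n w s) (l : Sg.L) (ts : (i : Fin n) → Term Sg (w i))
      (j : Fin n) (v : Term Sg (w j)) :
      Entails Sg Γ {.trans (.lab l) (ts j) v} →
      Entails Sg Γ {.trans (.lab l) (.app f ts) (.app f (Function.update ts j v))}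
  -- actions
  | compI {Sg : Signature.{u}} {Γ : Set (Sen Sg)} {s : Sg.S} {a b : Action Sg.L}
      {t₁ t t₂ : Term Sg s} :
      Entails Sg Γ {.trans a t₁ t} → Entails Sg Γ {.trans b t t₂} →
      Entails Sg Γ {.trans (.comp a b) t₁ t₂}
  | compE {Sg : Signature.{u}} {Γ : Set (Sen Sg)} {s : Sg.S} {a b : Action Sg.L}
      {t₁ t₂ : Term Sg s} {φ : Sen Sg} (i : ℕ) :
      Entails Sg Γ {.trans (.comp a b) t₁ t₂} →
      Entails (Sg.ext (.single i s))
        (Sen.wk (.single i s) '' Γ ∪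
          {.trans (Sg := Sg.ext (.single i s)) a (t₁.wk _)
              (.var ⟨i, Finset.mem_singleton_self i⟩),
            .trans (Sg := Sg.ext (.single i s)) b
              (.var ⟨i, Finset.mem_singleton_self i⟩) (t₂.wk _)})
        {φ.wk (.single i s)} →
      Entails Sg Γ {φ}
  | unionI₁ {Sg : Signature.{u}} {Γ : Set (Sen Sg)} {s : Sg.S} {a b : Action Sg.L}
      {t₁ t₂ : Term Sg s} :
      Entails Sg Γ {.trans a t₁ t₂} → Entails Sg Γ {.trans (.union a b) t₁ t₂}
  | unionI₂ {Sg : Signature.{u}} {Γ : Set (Sen Sg)} {s : Sg.S} {a b : Action Sg.L}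
      {t₁ t₂ : Term Sg s} :
      Entails Sg Γ {.trans b t₁ t₂} → Entails Sg Γ {.trans (.union a b) t₁ t₂}
  | unionE {Sg : Signature.{u}} {Γ : Set (Sen Sg)} {s : Sg.S} {a b : Action Sg.L}
      {t₁ t₂ : Term Sg s} {φ : Sen Sg} :
      Entails Sg Γ {.trans (.union a b) t₁ t₂} →
      Entails Sg (Γ ∪ {.trans a t₁ t₂}) {φ} → Entails Sg (Γ ∪ {.trans b t₁ t₂}) {φ} →
      Entails Sg Γ {φ}
  | starI {Sg : Signature.{u}} {Γ : Set (Sen Sg)} {s : Sg.S} {a : Action Sg.L}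
      {t₁ t₂ : Term Sg s} (n : ℕ) :
      Entails Sg Γ {.transPow a n t₁ t₂} → Entails Sg Γ {.trans (.star a) t₁ t₂}
  | starE {Sg : Signature.{u}} {Γ : Set (Sen Sg)} {s : Sg.S} {a : Action Sg.L}
      {t₁ t₂ : Term Sg s} {φ : Sen Sg} :
      Entails Sg Γ {.trans (.star a) t₁ t₂} →
      (∀ n : ℕ, Entails Sg (Γ ∪ {.transPow a n t₁ t₂}) {φ}) → Entails Sg Γ {φ}
  -- Boolean connectives
  | negD {Sg : Signature.{u}} {Γ : Set (Sen Sg)} {φ : Sen Sg} :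
      Entails Sg Γ {.neg (.neg φ)} → Entails Sg Γ {φ}
  | falseE {Sg : Signature.{u}} {Γ : Set (Sen Sg)} {φ : Sen Sg} :
      Entails Sg Γ {.bot} → Entails Sg Γ {φ}
  | negI {Sg : Signature.{u}} {Γ : Set (Sen Sg)} {φ : Sen Sg} :
      Entails Sg (Γ ∪ {φ}) {.bot} → Entails Sg Γ {.neg φ}
  | negE {Sg : Signature.{u}} {Γ : Set (Sen Sg)} {φ : Sen Sg} :
      Entails Sg Γ {.neg φ} → Entails Sg (Γ ∪ {φ}) {.bot}
  | disjI {Sg : Signature.{u}} {Γ : Set (Sen Sg)} {n : ℕ} {Φ : Fin n → Sen Sg} (i : Fin n) :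
      Entails Sg Γ {Φ i} → Entails Sg Γ {.disj Φ}
  | disjE {Sg : Signature.{u}} {Γ : Set (Sen Sg)} {n : ℕ} {Φ : Fin n → Sen Sg} {γ : Sen Sg} :
      Entails Sg Γ {.disj Φ} → (∀ i, Entails Sg (Γ ∪ {Φ i}) {γ}) → Entails Sg Γ {γ}
  -- quantifiers
  | quantI {Sg : Signature.{u}} {Γ : Set (Sen Sg)} {X : VarSet Sg.S} {φ : Sen (Sg.ext X)}
      {γ : Sen Sg} :
      Entails (Sg.ext X) (Sen.wk X '' Γ ∪ {φ}) {γ.wk X} → Entails Sg (Γ ∪ {.ex X φ}) {γ}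
  | quantE {Sg : Signature.{u}} {Γ : Set (Sen Sg)} {X : VarSet Sg.S} {φ : Sen (Sg.ext X)}
      {γ : Sen Sg} :
      Entails Sg (Γ ∪ {.ex X φ}) {γ} → Entails (Sg.ext X) (Sen.wk X '' Γ ∪ {φ}) {γ.wk X}
  | subst {Sg : Signature.{u}} {Γ : Set (Sen Sg)} {X : VarSet Sg.S} {φ : Sen (Sg.ext X)}
      (θ : (x : {i : ℕ // i ∈ X.names}) → Term Sg (X.sort x)) :
      Entails Sg Γ {φ.subst θ} → Entails Sg Γ {.ex X φ}

end TA

/-!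
Soundness is an induction on derivations; its one substantial ingredient is the satisfaction
condition `sat_map`, proved at once for signature morphisms and for substitutions by way of reducts
along the common generalization `Repl` of both.

Completeness is a Henkin construction in which the constants are added one finite set at a time.
Since carriers may be empty, it would be wrong to add constants of all sorts at the outset; and
since `starE` has infinitely many premises, consistency need not survive unions of chains of
theories. So no limit theory is formed. Over a countable signature there are countably many
sentences (`Signature.IsCountable.countable_sen`). A consistent theory over `Σ` can decide any given
sentence and, if it accepts it, witness it, at the cost of passing to `Σ[X]` for some finite `X`
(`Consistent.exists_witnessed`): the elimination rules for disjunctions, unions, iterations,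
compositions and quantifiers say exactly this. Iterating with a bookkeeping of all sentences over
all stages gives a `HenkinChain`: consistent theories over growing signatures such that each
sentence over any of the signatures is refuted or witnessed at some later stage.

Such a chain has a model. A sentence holds if the theory of some later stage entails it. The
elements are the terms over all stages, up to the equations that hold, and the truth lemma
`HenkinChain.sat_model_iff`, an induction on the depth of sentences, shows that satisfaction at each
stage is holding. In particular the model satisfies the theory at stage `0`, which is an arbitrary
consistent theory (`Consistent.exists_model`).
-/

namespace TA

/-! ### Composition of replacements -/

theorem Action.map_id {L : Type u} (a : Action L) : a.map (fun l => l) = a := by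
  induction a <;> simp_all [Action.map]

theorem Action.map_map {L L' L'' : Type u} (f : L → L') (g : L' → L'') (a : Action L) :
    (a.map f).map g = a.map (fun l => g (f l)) := by
  induction a <;> simp_all [Action.map]

theorem Action.map_succPow {L L' : Type u} (f : L → L') (a : Action L) (n : ℕ) :
    (a.succPow n).map f = (a.map f).succPow n := by
  induction n <;> simp_all [Action.map, Action.succPow]

/-- The action of a replacement on images: replace the symbol, or map the term. -/
def Image.bind {Sg Sg' : Signature.{u}} (ρ : Repl Sg Sg') {n : ℕ} {w : Fin n → Sg.S} {s : Sg.S} :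
    Image Sg n w s → Image Sg' n (fun i => ρ.sort (w i)) (ρ.sort s)
  | .sym f => ρ.op f
  | .tm t => .tm (t.map ρ)

/-- The composition of two replacements, `ρ` being applied first. -/
abbrev Repl.comp {Sg Sg' Sg'' : Signature.{u}} (ρ : Repl Sg Sg') (τ : Repl Sg' Sg'') :
    Repl Sg Sg'' where
  sort := fun s => τ.sort (ρ.sort s)
  op := fun f => (ρ.op f).bind τ
  lab := fun l => τ.lab (ρ.lab l)

theorem Image.map_apply {Sg Sg' : Signature.{u}} (ρ : Repl Sg Sg') {n : ℕ} {w : Fin n → Sg.S}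
    {s : Sg.S} (I : Image Sg n w s) (ts : (i : Fin n) → Term Sg (w i)) :
    (I.apply ts).map ρ = (I.bind ρ).apply (fun i => (ts i).map ρ) := by
  cases I with
  | sym f => simp only [Image.apply, Image.bind, Term.map]
  | tm t => simp only [Image.apply, Image.bind]

theorem Term.map_map {Sg Sg' Sg'' : Signature.{u}} (ρ : Repl Sg Sg') (τ : Repl Sg' Sg'')
    {s : Sg.S} (t : Term Sg s) : (t.map ρ).map τ = t.map (ρ.comp τ) := by
  induction t with
  | app f ts ih => simp only [Term.map, Image.map_apply, ih]

theorem Repl.ext_op {Sg Sg' : Signature.{u}} {σ : Sg.S → Sg'.S} {ℓ : Sg.L → Sg'.L}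
    {o o' : {n : ℕ} → {w : Fin n → Sg.S} → {s : Sg.S} → Sg.F n w s →
      Image Sg' n (fun i => σ (w i)) (σ s)}
    (h : ∀ {n : ℕ} {w : Fin n → Sg.S} {s : Sg.S} (f : Sg.F n w s), o f = o' f) :
    (⟨σ, o, ℓ⟩ : Repl Sg Sg') = ⟨σ, o', ℓ⟩ := by
  congr 1
  funext n w s f
  exact h f

theorem Image.bind_incl {Sg : Signature.{u}} (X : VarSet Sg.S) {n : ℕ} {w : Fin n → Sg.S}
    {s : Sg.S} (I : Image Sg n w s) : I.bind (incl Sg X).toRepl = I.lift X := by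
  cases I <;> rfl

/-- Weakening commutes with replacements. -/
theorem Term.map_incl {Sg Sg' : Signature.{u}} (ρ : Repl Sg Sg') (X : VarSet Sg.S) {s : Sg.S}
    (t : Term Sg s) :
    (t.map ρ).map (incl Sg' (X.map ρ.sort)).toRepl = (t.map (incl Sg X).toRepl).map (ρ.lift X) := by
  induction t with
  | app f ts ih =>
    simp only [Term.map, Image.map_apply, ih, Image.bind_incl]
    rfl

theorem Image.bind_lift {Sg Sg' : Signature.{u}} (τ : Repl Sg Sg') (X : VarSet Sg.S)
    {n : ℕ} {w : Fin n → Sg.S} {s : Sg.S} (I : Image Sg n w s) :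
    (I.bind τ).lift (X.map τ.sort) = (I.lift X).bind (τ.lift X) := by
  cases I with
  | sym f => rfl
  | tm t =>
    exact congrArg Image.tm (Term.map_incl τ X t)

theorem Repl.lift_comp {Sg Sg' Sg'' : Signature.{u}} (ρ : Repl Sg Sg') (τ : Repl Sg' Sg'')
    (X : VarSet Sg.S) :
    (ρ.comp τ).lift X = (ρ.lift X).comp (τ.lift (X.map ρ.sort)) := by
  refine Repl.ext_op ?_
  intro n (w : Fin n → Sg.S) (s : Sg.S) (f : ExtOp Sg X n w s)
  cases f with
  | old f => exact Image.bind_lift τ (X.map ρ.sort) (ρ.op f)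
  | var w x => rfl

theorem Sen.map_map {Sg Sg' Sg'' : Signature.{u}} (ρ : Repl Sg Sg') (τ : Repl Sg' Sg'')
    (φ : Sen Sg) : (φ.map ρ).map τ = φ.map (ρ.comp τ) := by
  induction φ generalizing Sg' Sg'' with
  | eq t u => simp only [Sen.map, Term.map_map]
  | trans a t u => simp only [Sen.map, Term.map_map, Action.map_map]
  | neg φ ih => simp only [Sen.map, ih]
  | disj Φ ih => simp only [Sen.map, ih]
  | ex X φ ih => simp only [Sen.map, Repl.lift_comp, ih]

theorem Sen.map_bot {Sg Sg' : Signature.{u}} (ρ : Repl Sg Sg') :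
    (Sen.bot : Sen Sg).map ρ = Sen.bot := by
  simp only [Sen.bot, Sen.map]
  congr 1
  funext i
  exact i.elim0

theorem Sen.map_transPow {Sg Sg' : Signature.{u}} (ρ : Repl Sg Sg') {s : Sg.S}
    (a : Action Sg.L) (n : ℕ) (t u : Term Sg s) :
    (Sen.transPow a n t u).map ρ = Sen.transPow (a.map ρ.lab) n (t.map ρ) (u.map ρ) := by
  cases n <;> simp only [Sen.transPow, Sen.map, Action.map_succPow]

/-- Two images act alike on arguments: they are equal, or differ only in presenting a constant
once as a symbol and once as a term. -/
inductive Image.Alike {Sg : Signature.{u}} :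
    {n : ℕ} → {w : Fin n → Sg.S} → {s : Sg.S} → Image Sg n w s → Image Sg n w s → Prop
  | refl {n : ℕ} {w : Fin n → Sg.S} {s : Sg.S} (I : Image Sg n w s) : Alike I I
  | const {w : Fin 0 → Sg.S} {s : Sg.S} (c : Sg.F 0 w s) (ts : (i : Fin 0) → Term Sg (w i)) :
      Alike (.tm (.app c ts)) (.sym c)

theorem Image.Alike.apply_eq {Sg : Signature.{u}} {n : ℕ} {w : Fin n → Sg.S} {s : Sg.S}
    {I J : Image Sg n w s} (h : I.Alike J) (ts : (i : Fin n) → Term Sg (w i)) :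
    I.apply ts = J.apply ts := by
  cases h with
  | refl => rfl
  | const c us =>
    simp only [Image.apply]
    congr 1
    funext i
    exact i.elim0

theorem Image.Alike.lift {Sg : Signature.{u}} {n : ℕ} {w : Fin n → Sg.S} {s : Sg.S}
    {I J : Image Sg n w s} (h : I.Alike J) (X : VarSet Sg.S) : (I.lift X).Alike (J.lift X) := by
  cases h with
  | refl => exact .refl _
  | const c us => exact .const (Sg := Sg.ext X) (ExtOp.old c) _

theorem Term.map_eq_self {Sg : Signature.{u}}
    (o : {n : ℕ} → {w : Fin n → Sg.S} → {s : Sg.S} → Sg.F n w s → Image Sg n w s)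
    (h : ∀ {n : ℕ} {w : Fin n → Sg.S} {s : Sg.S} (f : Sg.F n w s), (o f).Alike (.sym f))
    {s : Sg.S} (t : Term Sg s) : t.map ⟨fun s => s, o, fun l => l⟩ = t := by
  induction t with
  | app f ts ih =>
    simp only [Term.map]
    rw [(h f).apply_eq]
    simp only [Image.apply]
    congr 1
    funext i
    exact ih i

theorem Sen.map_eq_self {Sg : Signature.{u}}
    (o : {n : ℕ} → {w : Fin n → Sg.S} → {s : Sg.S} → Sg.F n w s → Image Sg n w s)
    (h : ∀ {n : ℕ} {w : Fin n → Sg.S} {s : Sg.S} (f : Sg.F n w s), (o f).Alike (.sym f))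
    (φ : Sen Sg) : φ.map ⟨fun s => s, o, fun l => l⟩ = φ := by
  induction φ with
  | eq t u => simp only [Sen.map, Term.map_eq_self o h]
  | trans a t u => simp only [Sen.map, Term.map_eq_self o h, Action.map_id]
  | neg φ ih => simp only [Sen.map, ih o h]
  | disj Φ ih => simp only [Sen.map, ih _ o h]
  | @ex Sg X φ ih =>
    simp only [Sen.map]
    congr 1
    refine ih _ ?_
    intro n (w : Fin n → Sg.S) (s : Sg.S) (f : ExtOp Sg X n w s)
    cases f with
    | old f => exact (h f).lift X
    | var w x => exact .refl _

/-- Instantiating, over `Σ[X]`, the variables bound by `∃ X` with the new constants `X` gives back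
the body: this is how the new constants of `Σ[X]` serve as witnesses. -/
theorem Sen.subst_var {Sg : Signature.{u}} (X : VarSet Sg.S) (φ : Sen (Sg.ext X)) :
    Sen.subst (Sg := Sg.ext X) (X := X) (fun x => Term.var x)
      (φ.map ((incl Sg X).toRepl.lift X)) = φ := by
  rw [Sen.subst, Sen.map_map]
  refine Sen.map_eq_self _ ?_ φ
  intro n (w : Fin n → Sg.S) (s : Sg.S) (f : ExtOp Sg X n w s)
  cases f with
  | old f => exact .refl _
  | var w x =>
    obtain rfl : w = Fin.elim0 := Subsingleton.elim _ _
    exact .const (Sg := Sg.ext X) (ExtOp.var Fin.elim0 x) _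

/-- The nesting depth of a sentence. -/
def Sen.depth : {Sg : Signature.{u}} → Sen Sg → ℕ
  | _, .eq _ _ => 0
  | _, .trans _ _ _ => 0
  | _, .neg φ => φ.depth + 1
  | _, .disj Φ => (Finset.univ.sup fun i => (Φ i).depth) + 1
  | _, .ex _ φ => φ.depth + 1

theorem Sen.depth_map {Sg Sg' : Signature.{u}} (ρ : Repl Sg Sg') (φ : Sen Sg) :
    (φ.map ρ).depth = φ.depth := by
  induction φ generalizing Sg' with
  | eq t u => rfl
  | trans a t u => rfl
  | neg φ ih => simp only [Sen.map, Sen.depth, ih]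
  | disj Φ ih => simp only [Sen.map, Sen.depth, ih]
  | ex X φ ih => simp only [Sen.map, Sen.depth, ih]

/-! ### Reducts and the satisfaction condition -/

/-- A replacement is monotone if it replaces monotonic symbols by monotonic symbols; nothing is
asked of constants, for which monotonicity is void. -/
def Repl.Monotone {Sg Sg' : Signature.{u}} (ρ : Repl Sg Sg') : Prop :=
  ∀ {n : ℕ} {w : Fin n → Sg.S} {s : Sg.S} (f : Sg.F n w s), f ∈ Sg.M n w s →
    n = 0 ∨ ∃ g ∈ Sg'.M n (fun i => ρ.sort (w i)) (ρ.sort s), ρ.op f = .sym g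

theorem Hom.toRepl_monotone {Sg Sg' : Signature.{u}} (χ : Hom Sg Sg') : χ.toRepl.Monotone :=
  fun f hf => .inr ⟨χ.op f, χ.mono f hf, rfl⟩

theorem substRepl_monotone {Sg : Signature.{u}} {X : VarSet Sg.S}
    (θ : (x : {i : ℕ // i ∈ X.names}) → Term Sg (X.sort x)) : (substRepl θ).Monotone := by
  rintro n w s f ⟨f, hf, rfl⟩
  exact .inr ⟨f, hf, rfl⟩

theorem Repl.Monotone.lift {Sg Sg' : Signature.{u}} {ρ : Repl Sg Sg'} (hρ : ρ.Monotone)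
    (X : VarSet Sg.S) : (ρ.lift X).Monotone := by
  rintro n w s f ⟨f, hf, rfl⟩
  rcases hρ f hf with h | ⟨g, hg, h⟩
  · exact .inl h
  · refine .inr ⟨ExtOp.old g, ⟨g, hg, rfl⟩, ?_⟩
    change (ρ.op f).lift (X.map ρ.sort) = _
    rw [h]
    rfl

/-- The interpretation of an image in a model. -/
def Model.image {Sg : Signature.{u}} (A : Model Sg) {n : ℕ} {w : Fin n → Sg.S} {s : Sg.S} :
    Image Sg n w s → ((i : Fin n) → A.carrier (w i)) → A.carrier s
  | .sym f, as => A.op f as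
  | .tm t, _ => A.eval t

/-- The reduct of a model along a monotone replacement. -/
abbrev Model.reduct {Sg Sg' : Signature.{u}} (A : Model Sg') (ρ : Repl Sg Sg') (hρ : ρ.Monotone) :
    Model Sg where
  carrier := fun s => A.carrier (ρ.sort s)
  op := fun f as => A.image (ρ.op f) as
  rel := fun l s => A.rel (ρ.lab l) (ρ.sort s)
  monotone := by
    intro n w s f hf l a k b h
    rcases hρ f hf with rfl | ⟨g, hg, h'⟩
    · exact k.elim0
    · rw [h']
      exact A.monotone g hg _ _ k b h

theorem Model.eval_image {Sg : Signature.{u}} (A : Model Sg) {n : ℕ} {w : Fin n → Sg.S} {s : Sg.S}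
    (I : Image Sg n w s) (ts : (i : Fin n) → Term Sg (w i)) :
    A.eval (I.apply ts) = A.image I (fun i => A.eval (ts i)) := by
  cases I <;> simp only [Image.apply, Model.image, Model.eval]

theorem Model.eval_map {Sg Sg' : Signature.{u}} (A : Model Sg') (ρ : Repl Sg Sg')
    (hρ : ρ.Monotone) {s : Sg.S} (t : Term Sg s) :
    A.eval (t.map ρ) = (A.reduct ρ hρ).eval t := by
  induction t with
  | app f ts ih => simp only [Term.map, Model.eval_image, Model.eval, ih]

theorem Model.act_map {Sg Sg' : Signature.{u}} (A : Model Sg') (ρ : Repl Sg Sg')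
    (hρ : ρ.Monotone) (a : Action Sg.L) (s : Sg.S) :
    A.act (a.map ρ.lab) (ρ.sort s) = (A.reduct ρ hρ).act a s := by
  induction a with
  | lab l => rfl
  | comp a b iha ihb => simp only [Action.map, Model.act, iha, ihb]
  | union a b iha ihb => simp only [Action.map, Model.act, iha, ihb]
  | star a ih => simp only [Action.map, Model.act, ih]

theorem Model.ext_op {Sg : Signature.{u}} {A B : Model Sg} (hc : A.carrier = B.carrier)
    (ho : HEq (@A.op) (@B.op)) (hr : HEq A.rel B.rel) : A = B := by
  cases A
  cases B
  cases hc
  cases ho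
  cases hr
  rfl

theorem Model.image_lift {Sg : Signature.{u}} (A : Model Sg) {X : VarSet Sg.S}
    (g : (x : {i : ℕ // i ∈ X.names}) → A.carrier (X.sort x)) {n : ℕ} {w : Fin n → Sg.S}
    {s : Sg.S} (I : Image Sg n w s) (as : (i : Fin n) → A.carrier (w i)) :
    (A.expand g).image (I.lift X) as = A.image I as := by
  cases I with
  | sym f => rfl
  | tm t => exact Model.eval_map _ _ (incl Sg X).toRepl_monotone t

/-- Expansion commutes with reducts. -/
theorem Model.reduct_expand {Sg Sg' : Signature.{u}} (A : Model Sg') (ρ : Repl Sg Sg')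
    (hρ : ρ.Monotone) (X : VarSet Sg.S)
    (g : (x : {i : ℕ // i ∈ X.names}) → A.carrier (ρ.sort (X.sort x))) :
    (A.expand (X := X.map ρ.sort) g).reduct (ρ.lift X) (hρ.lift X) = (A.reduct ρ hρ).expand g := by
  refine Model.ext_op rfl (heq_of_eq ?_) HEq.rfl
  funext n (w : Fin n → Sg.S) (s : Sg.S) (f : ExtOp Sg X n w s) as
  cases f with
  | old f => exact Model.image_lift A (X := X.map ρ.sort) g (ρ.op f) as
  | var w x => rfl

/-- The satisfaction condition, for signature morphisms and for substitutions. -/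
theorem sat_map {Sg Sg' : Signature.{u}} (A : Model Sg') (ρ : Repl Sg Sg')
    (hρ : ρ.Monotone) (φ : Sen Sg) : Sat A (φ.map ρ) ↔ Sat (A.reduct ρ hρ) φ := by
  induction φ generalizing Sg' with
  | eq t u => simp only [Sen.map, Sat, Model.eval_map A ρ hρ]
  | trans a t u => simp only [Sen.map, Sat, Model.eval_map A ρ hρ, Model.act_map A ρ hρ]
  | neg φ ih => simp only [Sen.map, Sat, ih A ρ hρ]
  | disj Φ ih => simp only [Sen.map, Sat, fun i => ih i A ρ hρ]
  | ex X φ ih =>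
    simp only [Sen.map, Sat]
    refine exists_congr fun g => ?_
    rw [ih _ _ (hρ.lift X), Model.reduct_expand]

theorem sat_wk {Sg : Signature.{u}} (A : Model Sg) {X : VarSet Sg.S}
    (g : (x : {i : ℕ // i ∈ X.names}) → A.carrier (X.sort x)) (φ : Sen Sg) :
    Sat (A.expand g) (φ.wk X) ↔ Sat A φ :=
  sat_map _ _ (incl Sg X).toRepl_monotone φ

theorem sat_subst {Sg : Signature.{u}} (A : Model Sg) {X : VarSet Sg.S}
    (θ : (x : {i : ℕ // i ∈ X.names}) → Term Sg (X.sort x)) (φ : Sen (Sg.ext X)) :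
    Sat A (φ.subst θ) ↔ Sat (A.expand fun x => A.eval (θ x)) φ := by
  rw [Sen.subst, sat_map A _ (substRepl_monotone θ)]
  have h : A.reduct (substRepl θ) (substRepl_monotone θ) = A.expand fun x => A.eval (θ x) := by
    refine Model.ext_op rfl (heq_of_eq ?_) HEq.rfl
    funext n (w : Fin n → Sg.S) (s : Sg.S) (f : ExtOp Sg X n w s) as
    cases f <;> rfl
  rw [h]

theorem Model.act_expand {Sg : Signature.{u}} (A : Model Sg) {X : VarSet Sg.S}
    (g : (x : {i : ℕ // i ∈ X.names}) → A.carrier (X.sort x)) (a : Action Sg.L) (s : Sg.S) :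
    (A.expand g).act a s = A.act a s := by
  induction a with
  | lab l => rfl
  | comp a b iha ihb => simp only [Model.act, iha, ihb]
  | union a b iha ihb => simp only [Model.act, iha, ihb]
  | star a ih => simp only [Model.act, ih]

theorem Model.eval_wk {Sg : Signature.{u}} (A : Model Sg) {X : VarSet Sg.S}
    (g : (x : {i : ℕ // i ∈ X.names}) → A.carrier (X.sort x)) {s : Sg.S} (t : Term Sg s) :
    (A.expand g).eval (t.wk X) = A.eval t :=
  Model.eval_map _ _ (incl Sg X).toRepl_monotone t

/-- Every `Σ[X]`-model is the expansion of its `Σ`-reduct by the values of the variables. -/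
theorem exists_expand {Sg : Signature.{u}} {X : VarSet Sg.S} (B : Model (Sg.ext X)) :
    ∃ (A : Model Sg) (g : (x : {i : ℕ // i ∈ X.names}) → A.carrier (X.sort x)),
      A.expand g = B := by
  refine ⟨B.reduct (incl Sg X).toRepl (incl Sg X).toRepl_monotone,
    fun x => B.op (ExtOp.var Fin.elim0 x) fun i => i.elim0, ?_⟩
  refine Model.ext_op rfl (heq_of_eq ?_) HEq.rfl
  funext n (w : Fin n → Sg.S) (s : Sg.S) (f : ExtOp Sg X n w s) as
  cases f with
  | old f => rfl
  | var w x =>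
    obtain rfl : w = Fin.elim0 := Subsingleton.elim _ _
    change B.op (ExtOp.var Fin.elim0 x) _ = _
    congr 1
    funext i
    exact i.elim0

theorem not_sat_bot {Sg : Signature.{u}} (A : Model Sg) : ¬ Sat A Sen.bot := by
  simp [Sen.bot, Sat]

/-! ### Soundness -/

theorem Model.act_succPow_reflTransGen {Sg : Signature.{u}} (A : Model Sg) (a : Action Sg.L)
    (s : Sg.S) (n : ℕ) {x y : A.carrier s} (h : A.act (a.succPow n) s x y) :
    Relation.ReflTransGen (A.act a s) x y := by
  induction n generalizing x with
  | zero => exact .single h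
  | succ n ih =>
    obtain ⟨z, hxz, hzy⟩ := h
    exact .head hxz (ih hzy)

theorem Model.exists_transPow {Sg : Signature.{u}} (A : Model Sg) {a : Action Sg.L}
    {s : Sg.S} {x y : A.carrier s} (h : Relation.ReflTransGen (A.act a s) x y) :
    x = y ∨ ∃ n, A.act (a.succPow n) s x y := by
  induction h using Relation.ReflTransGen.head_induction_on with
  | refl => exact .inl rfl
  | head hxz _ ih =>
    rcases ih with rfl | ⟨n, hn⟩
    · exact .inr ⟨0, hxz⟩
    · exact .inr ⟨n + 1, _, hxz, hn⟩

theorem sat_star_iff {Sg : Signature.{u}} (A : Model Sg) (a : Action Sg.L) {s : Sg.S}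
    (t u : Term Sg s) : Sat A (.trans (.star a) t u) ↔ ∃ n, Sat A (.transPow a n t u) := by
  constructor
  · intro h
    rcases A.exists_transPow h with h | ⟨n, h⟩
    · exact ⟨0, h⟩
    · exact ⟨n + 1, h⟩
  · rintro ⟨_ | n, h⟩
    · change A.eval t = A.eval u at h
      change Relation.ReflTransGen _ _ _
      rw [h]
    · exact A.act_succPow_reflTransGen a s n h

theorem Entails.sound {Sg : Signature.{u}} {Γ Φ : Set (Sen Sg)} (h : Entails Sg Γ Φ) :
    SemEntails Sg Γ Φ := by
  induction h with
  | monotonicity h => exact fun A hA φ hφ => hA φ (h hφ)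
  | transitivity _ _ ih₁ ih₂ => exact fun A hA => ih₂ A (ih₁ A hA)
  | union _ ih => exact fun A hA φ hφ => ih φ hφ A hA φ rfl
  | translation χ _ ih =>
    rintro A hA _ ⟨φ, hφ, rfl⟩
    refine (sat_map A _ χ.toRepl_monotone φ).2 (ih _ (fun γ hγ => ?_) φ hφ)
    exact (sat_map A _ χ.toRepl_monotone γ).1 (hA _ ⟨γ, hγ, rfl⟩)
  | refl t => rintro A hA _ rfl; rfl
  | symm _ ih => rintro A hA _ rfl; exact Eq.symm (ih A hA _ rfl)
  | eqTrans _ _ ih₁ ih₂ =>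
    rintro A hA _ rfl
    exact Eq.trans (ih₁ A hA _ rfl) (ih₂ A hA _ rfl)
  | congr f _ ih =>
    rintro A hA _ rfl
    simp only [Sat, Model.eval]
    congr 1
    funext i
    exact ih i A hA _ rfl
  | predCongr l _ _ _ ih₁ ih₂ ih₃ =>
    rintro A hA _ rfl
    have h₁ := ih₁ A hA _ rfl
    have h₂ := ih₂ A hA _ rfl
    have h₃ := ih₃ A hA _ rfl
    simp only [Sat] at h₁ h₂ h₃ ⊢
    rwa [← h₁, ← h₂]
  | mono f hf l ts j v _ ih =>
    rintro A hA _ rfl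
    have h := A.monotone f hf l (fun i => A.eval (ts i)) j (A.eval v) (ih A hA _ rfl)
    simp only [Sat, Model.eval, Model.act]
    convert h using 2
    funext i
    rw [Function.apply_update (fun i => A.eval (s := _))]
  | compI _ _ ih₁ ih₂ =>
    rintro A hA _ rfl
    exact ⟨_, ih₁ A hA _ rfl, ih₂ A hA _ rfl⟩
  | @compE Sg Γ s a b t₁ t₂ φ i _ _ ih₁ ih₂ =>
    rintro A hA _ rfl
    obtain ⟨x, hx₁, hx₂⟩ := ih₁ A hA _ rfl
    have key := ih₂ (A.expand (X := .single i s) fun _ => x) ?_ _ rfl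
    · exact (sat_wk A _ _).1 key
    · have ha := A.act_expand (X := .single i s) (fun _ => x) a s
      have hb := A.act_expand (X := .single i s) (fun _ => x) b s
      rintro _ (⟨γ, hγ, rfl⟩ | rfl | rfl)
      · exact (sat_wk A _ _).2 (hA γ hγ)
      · rw [← ha, ← A.eval_wk (X := .single i s) (fun _ => x) t₁] at hx₁
        exact hx₁
      · rw [← hb, ← A.eval_wk (X := .single i s) (fun _ => x) t₂] at hx₂
        exact hx₂
  | unionI₁ _ ih => rintro A hA _ rfl; exact Or.inl (ih A hA _ rfl)
  | unionI₂ _ ih => rintro A hA _ rfl; exact Or.inr (ih A hA _ rfl)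
  | unionE _ _ _ ih ih₁ ih₂ =>
    rintro A hA _ rfl
    rcases ih A hA _ rfl with h | h
    · exact ih₁ A (by rintro γ (hγ | rfl); exacts [hA γ hγ, h]) _ rfl
    · exact ih₂ A (by rintro γ (hγ | rfl); exacts [hA γ hγ, h]) _ rfl
  | starI n _ ih => rintro A hA _ rfl; exact (sat_star_iff A _ _ _).2 ⟨n, ih A hA _ rfl⟩
  | starE _ _ ih ih₁ =>
    rintro A hA _ rfl
    obtain ⟨n, h⟩ := (sat_star_iff A _ _ _).1 (ih A hA _ rfl)
    exact ih₁ n A (by rintro γ (hγ | rfl); exacts [hA γ hγ, h]) _ rfl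
  | negD _ ih => rintro A hA _ rfl; exact not_not.1 (ih A hA _ rfl)
  | falseE _ ih => intro A hA; exact absurd (ih A hA _ rfl) (not_sat_bot A)
  | negI _ ih =>
    rintro A hA _ rfl h
    exact not_sat_bot A (ih A (by rintro γ (hγ | rfl); exacts [hA γ hγ, h]) _ rfl)
  | negE _ ih =>
    rintro A hA
    exact absurd (hA _ (.inr rfl)) (ih A (fun γ hγ => hA γ (.inl hγ)) _ rfl)
  | disjI i _ ih => rintro A hA _ rfl; exact ⟨i, ih A hA _ rfl⟩
  | disjE _ _ ih ih₁ =>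
    rintro A hA _ rfl
    obtain ⟨i, h⟩ := ih A hA _ rfl
    exact ih₁ i A (by rintro γ (hγ | rfl); exacts [hA γ hγ, h]) _ rfl
  | quantI _ ih =>
    rintro A hA _ rfl
    obtain ⟨g, hg⟩ := hA _ (.inr rfl)
    refine (sat_wk A g _).1 (ih _ ?_ _ rfl)
    rintro _ (⟨γ, hγ, rfl⟩ | rfl)
    exacts [(sat_wk A g γ).2 (hA γ (.inl hγ)), hg]
  | quantE _ ih =>
    rintro B hB _ rfl
    obtain ⟨A, g, rfl⟩ := exists_expand B
    refine (sat_wk A g _).2 (ih A ?_ _ rfl)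
    rintro γ (hγ | rfl)
    exacts [(sat_wk A g γ).1 (hB _ (.inl ⟨γ, hγ, rfl⟩)), ⟨g, hB _ (.inr rfl)⟩]
  | subst θ _ ih =>
    rintro A hA _ rfl
    exact ⟨_, (sat_subst A θ _).1 (ih A hA _ rfl)⟩

/-! ### Countability of the syntax -/

/-- A type is countable if the elements of every bounded depth are countably many. -/
theorem countable_of_depth {α : Type*} (depth : α → ℕ)
    (h : ∀ d, {a | depth a < d}.Countable) : Countable α := by
  rw [← Set.countable_univ_iff]
  refine (Set.countable_iUnion h).mono fun a _ => ?_
  exact Set.mem_iUnion.2 ⟨depth a + 1, Nat.lt_succ_self _⟩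

/-- The nesting depth of an action. -/
def Action.depth {L : Type u} : Action L → ℕ
  | .lab _ => 0
  | .comp a b => max a.depth b.depth + 1
  | .union a b => max a.depth b.depth + 1
  | .star a => a.depth + 1

instance Action.countable {L : Type u} [Countable L] : Countable (Action L) := by
  refine countable_of_depth Action.depth fun d => ?_
  induction d with
  | zero => simp
  | succ d ih =>
    have := ih.to_subtype
    let D := {a : Action L | a.depth < d}
    refine (((Set.countable_range (Action.lab : L → _)).union
      (Set.countable_range fun p : D × D => Action.comp p.1.1 p.2.1)).union
      ((Set.countable_range fun p : D × D => Action.union p.1.1 p.2.1).union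
      (Set.countable_range fun p : D => Action.star p.1))).mono fun a ha => ?_
    cases a with
    | lab l => exact .inl (.inl ⟨l, rfl⟩)
    | comp a b =>
      simp only [Set.mem_ofPred_eq, Action.depth, Nat.add_lt_add_iff_right, max_lt_iff] at ha
      exact .inl (.inr ⟨(⟨a, ha.1⟩, ⟨b, ha.2⟩), rfl⟩)
    | union a b =>
      simp only [Set.mem_ofPred_eq, Action.depth, Nat.add_lt_add_iff_right, max_lt_iff] at ha
      exact .inr (.inl ⟨(⟨a, ha.1⟩, ⟨b, ha.2⟩), rfl⟩)
    | star a =>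
      simp only [Set.mem_ofPred_eq, Action.depth, Nat.add_lt_add_iff_right] at ha
      exact .inr (.inr ⟨⟨a, ha⟩, rfl⟩)

/-- The nesting depth of a term; constants have depth `1`. -/
def Term.depth {Sg : Signature.{u}} : {s : Sg.S} → Term Sg s → ℕ
  | _, .app _ ts => (Finset.univ.sup fun i => (ts i).depth) + 1

theorem Signature.IsCountable.countable_op {Sg : Signature.{u}} (h : Sg.IsCountable) (n : ℕ)
    (w : Fin n → Sg.S) (s : Sg.S) : Countable (Sg.F n w s) := by
  have := h.2.1
  refine Function.Injective.countable (f := fun f : Sg.F n w s =>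
    (⟨n, w, s, f⟩ : Σ (n : ℕ) (w : Fin n → Sg.S) (s : Sg.S), Sg.F n w s)) fun f g hfg => ?_
  simpa using hfg

theorem Signature.IsCountable.countable_term {Sg : Signature.{u}} (h : Sg.IsCountable) (s : Sg.S) :
    Countable (Term Sg s) := by
  refine countable_of_depth Term.depth fun d => ?_
  have := h.1
  have := h.countable_op
  induction d generalizing s with
  | zero => simp
  | succ d ih =>
    have := fun s => (ih s).to_subtype
    let D (s : Sg.S) := {t : Term Sg s | t.depth < d}
    refine (Set.countable_range
      fun p : Σ (n : ℕ) (w : Fin n → Sg.S), Sg.F n w s × ((i : Fin n) → D (w i)) =>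
        Term.app p.2.2.1 fun i => (p.2.2.2 i).1).mono fun t ht => ?_
    cases t with
    | @app n w _ f ts =>
      simp only [Set.mem_ofPred_eq, Term.depth, Nat.add_lt_add_iff_right] at ht
      exact ⟨⟨n, w, f, fun i => ⟨ts i, (Finset.le_sup (f := fun i => (ts i).depth)
        (Finset.mem_univ i)).trans_lt ht⟩⟩, rfl⟩

instance VarSet.countable {S : Type u} [Countable S] : Countable (VarSet S) := by
  refine Function.Injective.countable (f := fun X : VarSet S =>
    (⟨X.names, X.sort⟩ : Σ N : Finset ℕ, ({i : ℕ // i ∈ N} → S))) ?_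
  rintro ⟨N, σ⟩ ⟨N', σ'⟩ h
  cases h
  rfl

theorem Signature.IsCountable.ext {Sg : Signature.{u}} (h : Sg.IsCountable) (X : VarSet Sg.S) :
    (Sg.ext X).IsCountable := by
  refine ⟨h.1, ?_, h.2.2⟩
  have := h.2.1
  let f : (Σ (n : ℕ) (w : Fin n → Sg.S) (s : Sg.S), Sg.F n w s) ⊕ {i : ℕ // i ∈ X.names} →
      Σ (n : ℕ) (w : Fin n → Sg.S) (s : Sg.S), ExtOp Sg X n w s
    | .inl f => ⟨f.1, f.2.1, f.2.2.1, .old f.2.2.2⟩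
    | .inr x => ⟨0, Fin.elim0, X.sort x, .var Fin.elim0 x⟩
  refine Function.Surjective.countable (f := f) ?_
  rintro ⟨n, (w : Fin n → Sg.S), (s : Sg.S), (g : ExtOp Sg X n w s)⟩
  cases g with
  | old g => exact ⟨.inl ⟨n, w, s, g⟩, rfl⟩
  | var w x =>
    obtain rfl : w = Fin.elim0 := Subsingleton.elim _ _
    exact ⟨.inr x, rfl⟩

theorem Signature.IsCountable.countable_sen {Sg : Signature.{u}} (h : Sg.IsCountable) :
    Countable (Sen Sg) := by
  refine countable_of_depth Sen.depth fun d => ?_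
  induction d generalizing Sg with
  | zero => simp
  | succ d ih =>
    have := h.1
    have := h.2.2
    have := h.countable_term
    have := (ih h).to_subtype
    have := fun X => (ih (h.ext X)).to_subtype
    let D (Sg : Signature.{u}) := {φ : Sen Sg | φ.depth < d}
    refine (((Set.countable_range fun p : Σ s : Sg.S, Term Sg s × Term Sg s =>
        Sen.eq p.2.1 p.2.2).union
      (Set.countable_range fun p : Σ s : Sg.S, Action Sg.L × Term Sg s × Term Sg s =>
        Sen.trans p.2.1 p.2.2.1 p.2.2.2)).union
      ((Set.countable_range fun p : D Sg => Sen.neg p.1).union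
      ((Set.countable_range fun p : Σ n : ℕ, (Fin n → D Sg) => Sen.disj fun i => (p.2 i).1).union
      (Set.countable_range fun p : Σ X : VarSet Sg.S, D (Sg.ext X) => Sen.ex p.1 p.2.1)))).mono
      fun φ hφ => ?_
    cases φ with
    | eq t u => exact .inl (.inl ⟨⟨_, t, u⟩, rfl⟩)
    | trans a t u => exact .inl (.inr ⟨⟨_, a, t, u⟩, rfl⟩)
    | neg φ =>
      simp only [Set.mem_ofPred_eq, Sen.depth, Nat.add_lt_add_iff_right] at hφ
      exact .inr (.inl ⟨⟨φ, hφ⟩, rfl⟩)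
    | @disj _ n Φ =>
      simp only [Set.mem_ofPred_eq, Sen.depth, Nat.add_lt_add_iff_right] at hφ
      exact .inr (.inr (.inl ⟨⟨n, fun i => ⟨Φ i, (Finset.le_sup (f := fun i => (Φ i).depth)
        (Finset.mem_univ i)).trans_lt hφ⟩⟩, rfl⟩))
    | ex X φ =>
      simp only [Set.mem_ofPred_eq, Sen.depth, Nat.add_lt_add_iff_right] at hφ
      exact .inr (.inr (.inr ⟨⟨X, ⟨φ, hφ⟩⟩, rfl⟩))

theorem Signature.IsCountable.exists_enumeration {Sg : Signature.{u}}
    (h : Sg.IsCountable) : ∃ e : ℕ → Sen Sg, Function.Surjective e :=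
  have := h.countable_sen
  have : Nonempty (Sen Sg) := ⟨Sen.bot⟩
  exists_surjective_nat _

/-! ### Consistency and witnesses -/

theorem Entails.weaken {Sg : Signature.{u}} {Γ Γ' Φ : Set (Sen Sg)} (h : Entails Sg Γ Φ)
    (hΓ : Γ ⊆ Γ') : Entails Sg Γ' Φ :=
  .transitivity (.monotonicity hΓ) h

theorem Entails.of_mem {Sg : Signature.{u}} {Γ : Set (Sen Sg)} {φ : Sen Sg} (h : φ ∈ Γ) :
    Entails Sg Γ {φ} :=
  .monotonicity (Set.singleton_subset_iff.2 h)

theorem Entails.cut {Sg : Signature.{u}} {Γ : Set (Sen Sg)} {φ ψ : Sen Sg}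
    (h : Entails Sg Γ {φ}) (h' : Entails Sg (Γ ∪ {φ}) {ψ}) : Entails Sg Γ {ψ} := by
  refine .transitivity (.union ?_) h'
  rintro γ (hγ | rfl)
  exacts [.of_mem hγ, h]

/-- A set of sentences is consistent if it does not entail falsity. -/
def Consistent {Sg : Signature.{u}} (T : Set (Sen Sg)) : Prop := ¬ Entails Sg T {Sen.bot}

theorem Entails.bot_of_neg {Sg : Signature.{u}} {Γ : Set (Sen Sg)} {φ : Sen Sg}
    (h : Entails Sg Γ {φ}) (h' : Entails Sg Γ {φ.neg}) : Entails Sg Γ {Sen.bot} :=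
  h.cut (.negE h')

theorem Consistent.insert_or {Sg : Signature.{u}} {T : Set (Sen Sg)} (hT : Consistent T)
    (φ : Sen Sg) : Consistent (T ∪ {φ}) ∨ Consistent (T ∪ {φ.neg}) := by
  by_contra! h
  have h₁ := Entails.negI (not_not.1 h.1)
  exact hT (h₁.cut (not_not.1 h.2))

/-- Consistency is preserved by the extension of the signature by an empty set of variables. -/
theorem Consistent.wk_empty {Sg : Signature.{u}} {T : Set (Sen Sg)} (hT : Consistent T)
    (σ : {i : ℕ // i ∈ (∅ : Finset ℕ)} → Sg.S) : Consistent (Sen.wk ⟨∅, σ⟩ '' T) := by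
  intro h
  have top {Sg : Signature.{u}} {T : Set (Sen Sg)} : Entails Sg T {Sen.bot.neg} :=
    .negI (.of_mem (.inr rfl))
  refine hT (Entails.cut (φ := .ex ⟨∅, σ⟩ Sen.bot.neg) ?_ (.quantI ?_))
  · refine .subst (fun x => absurd x.2 (Finset.notMem_empty _)) ?_
    simp only [Sen.subst, Sen.map, Sen.map_bot]
    exact top
  · rw [Sen.wk, Sen.translate, Sen.map_bot]
    exact h.weaken Set.subset_union_left

/-- `T` contains witnesses for the sentence: the components, disjunct, exponent, intermediate point
or instance from which the sentence follows by an introduction rule. -/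
def Witnessed {Sg : Signature.{u}} (T : Set (Sen Sg)) : Sen Sg → Prop
  | .eq t u => .eq t u ∈ T
  | .trans (.lab l) t u => .trans (.lab l) t u ∈ T
  | .trans (.comp a b) t u => ∃ v, .trans a t v ∈ T ∧ .trans b v u ∈ T
  | .trans (.union a b) t u => .trans a t u ∈ T ∨ .trans b t u ∈ T
  | .trans (.star a) t u => ∃ n, .transPow a n t u ∈ T
  | .disj Φ => ∃ i, Φ i ∈ T
  | .neg φ => .neg φ ∈ T
  | .ex _ φ => ∃ θ, φ.subst θ ∈ T

theorem Witnessed.entails {Sg : Signature.{u}} {T : Set (Sen Sg)} {φ : Sen Sg}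
    (h : Witnessed T φ) : Entails Sg T {φ} := by
  cases φ with
  | eq t u => exact .of_mem h
  | trans a t u =>
    cases a with
    | lab l => exact .of_mem h
    | comp a b =>
      obtain ⟨v, h₁, h₂⟩ := h
      exact .compI (.of_mem h₁) (.of_mem h₂)
    | union a b =>
      rcases h with h | h
      exacts [.unionI₁ (.of_mem h), .unionI₂ (.of_mem h)]
    | star a =>
      obtain ⟨n, h⟩ := h
      exact .starI n (.of_mem h)
  | neg φ => exact .of_mem h
  | disj Φ =>
    obtain ⟨i, h⟩ := h
    exact .disjI i (.of_mem h)
  | ex X φ =>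
    obtain ⟨θ, h⟩ := h
    exact .subst θ (.of_mem h)

/-- A consistent theory decides any given sentence consistently, and with witnesses, after
extending the signature by a finite set of variables. -/
theorem Consistent.exists_witnessed {Sg : Signature.{u}} {T : Set (Sen Sg)} (hT : Consistent T)
    (φ : Sen Sg) : ∃ (X : VarSet Sg.S) (T' : Set (Sen (Sg.ext X))), Sen.wk X '' T ⊆ T' ∧
      Consistent T' ∧ (.neg (φ.wk X) ∈ T' ∨ Witnessed T' (φ.wk X)) := by
  let σ : {i : ℕ // i ∈ (∅ : Finset ℕ)} → Sg.S := fun x => absurd x.2 (Finset.notMem_empty _)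
  -- The cases without new constants: it suffices to add a witness over `Σ` itself.
  have add (ψ : Sen Sg) (h : Consistent (T ∪ {ψ}))
      (hw : ∀ T' : Set (Sen (Sg.ext ⟨∅, σ⟩)), ψ.wk _ ∈ T' →
        .neg (φ.wk _) ∈ T' ∨ Witnessed T' (φ.wk _)) :
      ∃ (X : VarSet Sg.S) (T' : Set (Sen (Sg.ext X))), Sen.wk X '' T ⊆ T' ∧
        Consistent T' ∧ (.neg (φ.wk X) ∈ T' ∨ Witnessed T' (φ.wk X)) :=
    ⟨⟨∅, σ⟩, Sen.wk _ '' (T ∪ {ψ}), Set.image_mono Set.subset_union_left, h.wk_empty σ,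
      hw _ (Set.mem_image_of_mem _ (Set.mem_union_right T (Set.mem_singleton ψ)))⟩
  rcases (hT.insert_or φ).symm with h | h
  · exact add _ h fun T' h' => .inl h'
  cases φ with
  | eq t u => exact add _ h fun T' h' => .inr h'
  | neg φ => exact add _ h fun T' h' => .inr h'
  | disj Φ =>
    by_cases h₁ : ∃ i, Consistent (T ∪ {Φ i})
    · obtain ⟨i, h₁⟩ := h₁
      exact add _ h₁ fun T' h' => .inr (Exists.intro i h')
    · push Not at h₁
      exact absurd (Entails.disjE (.of_mem (.inr rfl)) fun i =>
        (not_not.1 (h₁ i)).weaken (Set.union_subset_union_left _ Set.subset_union_left)) h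
  | ex X φ =>
    refine ⟨X, Sen.wk X '' T ∪ {φ}, Set.subset_union_left, fun h' => h ?_, .inr ?_⟩
    · refine .quantI ?_
      rw [Sen.wk, Sen.translate, Sen.map_bot]
      exact h'
    · exact Exists.intro (fun x => Term.var (X := X) x) (.inr (Sen.subst_var X φ))
  | @trans _ s a t u =>
    cases a with
    | lab l => exact add _ h fun T' h' => .inr h'
    | union a b =>
      by_cases h₁ : Consistent (T ∪ {.trans a t u})
      · exact add _ h₁ fun T' h' => .inr (Or.inl h')
      · by_cases h₂ : Consistent (T ∪ {.trans b t u})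
        · exact add _ h₂ fun T' h' => .inr (Or.inr h')
        · exact absurd (Entails.unionE (.of_mem (.inr rfl))
            ((not_not.1 h₁).weaken (Set.union_subset_union_left _ Set.subset_union_left))
            ((not_not.1 h₂).weaken (Set.union_subset_union_left _ Set.subset_union_left))) h
    | star a =>
      by_cases h₁ : ∃ n, Consistent (T ∪ {.transPow a n t u})
      · obtain ⟨n, h₁⟩ := h₁
        refine add _ h₁ fun T' h' => .inr (Exists.intro n ?_)
        rw [Sen.wk, Sen.translate, Sen.map_transPow] at h'
        exact h'
      · push Not at h₁
        exact absurd (Entails.starE (.of_mem (.inr rfl)) fun n =>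
          (not_not.1 (h₁ n)).weaken (Set.union_subset_union_left _ Set.subset_union_left)) h
    | comp a b =>
      refine ⟨.single 0 s, Sen.wk (.single 0 s) '' (T ∪ {.trans (.comp a b) t u}) ∪
          {.trans (Sg := Sg.ext (.single 0 s)) a (t.wk _)
              (.var ⟨0, Finset.mem_singleton_self 0⟩),
            .trans (Sg := Sg.ext (.single 0 s)) b
              (.var ⟨0, Finset.mem_singleton_self 0⟩) (u.wk _)},
        (Set.image_mono Set.subset_union_left).trans Set.subset_union_left, fun h' => h ?_, .inr ?_⟩
      · refine .compE 0 (.of_mem (.inr rfl)) ?_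
        rw [Sen.wk, Sen.translate, Sen.map_bot]
        exact h'
      · simp only [Sen.wk, Sen.translate, Sen.map, Action.map, Action.map_id]
        exact Exists.intro (Term.var ⟨0, Finset.mem_singleton_self 0⟩)
          ⟨.inr (.inl rfl), .inr (.inr rfl)⟩

/-! ### Henkin chains -/

/-- A chain of signatures with fixed sorts and labels, and growing function symbols. -/
structure SigChain (S L : Type u) where
  F : ℕ → (n : ℕ) → (Fin n → S) → S → Type u
  M : (k n : ℕ) → (w : Fin n → S) → (s : S) → Set (F k n w s)
  inc : (k : ℕ) → {n : ℕ} → {w : Fin n → S} → {s : S} → F k n w s → F (k + 1) n w s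
  inc_mono : ∀ (k : ℕ) {n : ℕ} {w : Fin n → S} {s : S} (f : F k n w s),
    f ∈ M k n w s → inc k f ∈ M (k + 1) n w s

namespace SigChain

variable {S L : Type u} (C : SigChain.{u} S L)

/-- The `k`-th signature of the chain. -/
abbrev sig (k : ℕ) : Signature.{u} := ⟨S, C.F k, C.M k, L⟩

/-- The inclusion of the `k`-th signature into the next one. -/
abbrev hom (k : ℕ) : Hom (C.sig k) (C.sig (k + 1)) where
  sort := fun s => s
  op := C.inc k
  mono := C.inc_mono k
  lab := fun l => l

/-- A symbol, as a symbol of a later signature. -/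
def upOp {k m : ℕ} (h : k ≤ m) {n : ℕ} {w : Fin n → S} {s : S} (f : C.F k n w s) : C.F m n w s :=
  Nat.leRecOn (C := fun k => C.F k n w s) h (fun {k} f => C.inc k f) f

/-- A term, as a term over a later signature. -/
def upTerm {k m : ℕ} (h : k ≤ m) {s : S} (t : Term (C.sig k) s) : Term (C.sig m) s :=
  Nat.leRecOn (C := fun k => Term (C.sig k) s) h (fun {k} t => t.map (C.hom k).toRepl) t

/-- A sentence, as a sentence over a later signature. -/
def up {k m : ℕ} (h : k ≤ m) (φ : Sen (C.sig k)) : Sen (C.sig m) :=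
  Nat.leRecOn (C := fun k => Sen (C.sig k)) h (fun {k} φ => φ.translate (C.hom k)) φ

/-- The body of a quantified sentence, as such a body over a later signature. -/
def upBody {k m : ℕ} (h : k ≤ m) (X : VarSet S) (φ : Sen ((C.sig k).ext X)) :
    Sen ((C.sig m).ext X) :=
  Nat.leRecOn (C := fun k => Sen ((C.sig k).ext X)) h
    (fun {k} φ => φ.map ((C.hom k).toRepl.lift X)) φ

variable {C} {k m m' : ℕ}

theorem upOp_self {n : ℕ} {w : Fin n → S} {s : S} (f : C.F k n w s) :
    C.upOp le_rfl f = f := Nat.leRecOn_self _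

theorem upTerm_self {s : S} (t : Term (C.sig k) s) : C.upTerm le_rfl t = t := Nat.leRecOn_self _

theorem up_self (φ : Sen (C.sig k)) : C.up le_rfl φ = φ := Nat.leRecOn_self _

theorem upBody_self {X : VarSet S} (φ : Sen ((C.sig k).ext X)) : C.upBody le_rfl X φ = φ :=
  Nat.leRecOn_self _

theorem upOp_succ (h : k ≤ m) {n : ℕ} {w : Fin n → S} {s : S} (f : C.F k n w s) :
    C.upOp (h.trans m.le_succ) f = C.inc m (C.upOp h f) := Nat.leRecOn_succ _ _

theorem upTerm_succ (h : k ≤ m) {s : S} (t : Term (C.sig k) s) :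
    C.upTerm (h.trans m.le_succ) t = (C.upTerm h t).map (C.hom m).toRepl := Nat.leRecOn_succ _ _

theorem up_succ (h : k ≤ m) (φ : Sen (C.sig k)) :
    C.up (h.trans m.le_succ) φ = (C.up h φ).translate (C.hom m) := Nat.leRecOn_succ _ _

theorem upBody_succ (h : k ≤ m) {X : VarSet S} (φ : Sen ((C.sig k).ext X)) :
    C.upBody (h.trans m.le_succ) X φ = (C.upBody h X φ).map ((C.hom m).toRepl.lift X) :=
  Nat.leRecOn_succ _ _

theorem upOp_upOp (h : k ≤ m) (h' : m ≤ m') {n : ℕ} {w : Fin n → S} {s : S} (f : C.F k n w s) :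
    C.upOp h' (C.upOp h f) = C.upOp (h.trans h') f := (Nat.leRecOn_trans _ _ _).symm

theorem upTerm_upTerm (h : k ≤ m) (h' : m ≤ m') {s : S} (t : Term (C.sig k) s) :
    C.upTerm h' (C.upTerm h t) = C.upTerm (h.trans h') t := (Nat.leRecOn_trans _ _ _).symm

theorem up_up (h : k ≤ m) (h' : m ≤ m') (φ : Sen (C.sig k)) :
    C.up h' (C.up h φ) = C.up (h.trans h') φ := (Nat.leRecOn_trans _ _ _).symm

theorem upOp_mono (h : k ≤ m) {n : ℕ} {w : Fin n → S} {s : S} {f : C.F k n w s}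
    (hf : f ∈ C.M k n w s) : C.upOp h f ∈ C.M m n w s := by
  induction h with
  | refl => rwa [upOp_self]
  | step h ih => rw [upOp_succ h]; exact C.inc_mono _ _ ih

theorem upTerm_app (h : k ≤ m) {n : ℕ} {w : Fin n → S} {s : S} (f : C.F k n w s)
    (ts : (i : Fin n) → Term (C.sig k) (w i)) :
    C.upTerm h (.app f ts) = .app (Sg := C.sig m) (C.upOp h f) fun i => C.upTerm h (ts i) := by
  induction h with
  | refl => simp only [upTerm_self, upOp_self]
  | step h ih => rw [upTerm_succ h, ih]; simp only [upOp_succ h, upTerm_succ h]; rfl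

theorem up_eq (h : k ≤ m) {s : S} (t u : Term (C.sig k) s) :
    C.up h (.eq t u) = .eq (Sg := C.sig m) (C.upTerm h t) (C.upTerm h u) := by
  induction h with
  | refl => simp only [upTerm_self, up_self]
  | step h ih => rw [up_succ h, ih, upTerm_succ h, upTerm_succ h]; rfl

theorem up_trans (h : k ≤ m) {s : S} (a : Action L) (t u : Term (C.sig k) s) :
    C.up h (.trans a t u) = .trans (Sg := C.sig m) a (C.upTerm h t) (C.upTerm h u) := by
  induction h with
  | refl => simp only [upTerm_self, up_self]
  | step h ih =>
    rw [up_succ h, ih, upTerm_succ h, upTerm_succ h]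
    simp only [Sen.translate, Sen.map, Action.map_id]

theorem up_transPow (h : k ≤ m) {s : S} (a : Action L) (n : ℕ) (t u : Term (C.sig k) s) :
    C.up h (.transPow a n t u) =
      .transPow (Sg := C.sig m) a n (C.upTerm h t) (C.upTerm h u) := by
  cases n
  exacts [up_eq h t u, up_trans h _ t u]

theorem up_neg (h : k ≤ m) (φ : Sen (C.sig k)) : C.up h φ.neg = (C.up h φ).neg := by
  induction h with
  | refl => simp only [up_self]
  | step h ih => rw [up_succ h, ih, up_succ h]; rfl

theorem up_disj (h : k ≤ m) {n : ℕ} (Φ : Fin n → Sen (C.sig k)) :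
    C.up h (.disj Φ) = .disj fun i => C.up h (Φ i) := by
  induction h with
  | refl => simp only [up_self]
  | step h ih => rw [up_succ h, ih]; simp only [up_succ h]; rfl

theorem up_bot (h : k ≤ m) : C.up h Sen.bot = Sen.bot := by
  rw [Sen.bot, up_disj, Sen.bot]
  congr 1
  funext i
  exact i.elim0

theorem up_ex (h : k ≤ m) (X : VarSet S) (φ : Sen ((C.sig k).ext X)) :
    C.up h (.ex X φ) = .ex (Sg := C.sig m) X (C.upBody h X φ) := by
  induction h with
  | refl => simp only [up_self, upBody_self]
  | step h ih => rw [up_succ h, ih, upBody_succ h]; rfl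

theorem depth_upBody (h : k ≤ m) (X : VarSet S) (φ : Sen ((C.sig k).ext X)) :
    (C.upBody h X φ).depth = φ.depth := by
  induction h with
  | refl => rw [upBody_self]
  | step h ih => rw [upBody_succ h, Sen.depth_map, ih]

theorem entails_up (h : k ≤ m) {Γ Φ : Set (Sen (C.sig k))} (hΓ : Entails (C.sig k) Γ Φ) :
    Entails (C.sig m) (C.up h '' Γ) (C.up h '' Φ) := by
  induction h with
  | refl => simpa only [up_self, Set.image_id'] using hΓ
  | step h ih =>
    have := ih.translation (C.hom _)
    simpa only [Set.image_image, ← up_succ h] using this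

end SigChain

/-- A chain of consistent theories over a chain of signatures in which every sentence over any of
the signatures is, at some later stage, either refuted or witnessed. -/
structure HenkinChain (S L : Type u) extends SigChain.{u} S L where
  T : (k : ℕ) → Set (Sen (toSigChain.sig k))
  consistent : ∀ k, Consistent (T k)
  translate_mem : ∀ {k : ℕ} {φ : Sen (toSigChain.sig k)}, φ ∈ T k →
    φ.translate (toSigChain.hom k) ∈ T (k + 1)
  witnessed : ∀ {k : ℕ} (φ : Sen (toSigChain.sig k)), ∃ (m : ℕ) (h : k ≤ m),
    (toSigChain.up h φ).neg ∈ T m ∨ Witnessed (T m) (toSigChain.up h φ)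

/-- A stage of the construction of a Henkin chain over the sorts `S` and labels `L`: a countable
signature, a consistent theory, and the sentences that have to be treated, `queue i` being an
enumeration of those over stage `i`. At a stage `k`, only the values of `queue i` for `i ≤ k`
matter. -/
structure Stage (S L : Type u) where
  F : (n : ℕ) → (Fin n → S) → S → Type u
  M : (n : ℕ) → (w : Fin n → S) → (s : S) → Set (F n w s)
  countable : Signature.IsCountable ⟨S, F, M, L⟩
  T : Set (Sen (⟨S, F, M, L⟩ : Signature.{u}))
  consistent : Consistent T
  queue : ℕ → ℕ → Sen (⟨S, F, M, L⟩ : Signature.{u})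

namespace Stage

variable {S L : Type u}

/-- The signature of a stage. -/
abbrev sig (p : Stage.{u} S L) : Signature.{u} := ⟨S, p.F, p.M, L⟩

/-- The variables added after stage `k`. -/
noncomputable def vars (p : Stage.{u} S L) (k : ℕ) : VarSet S :=
  (p.consistent.exists_witnessed (p.queue k.unpair.1 k.unpair.2)).choose

/-- The stage after stage `k`. It treats the sentence in the queue which the pairing function
assigns to `k`; the sentences over the new signature join the queue. -/
noncomputable def next (p : Stage.{u} S L) (k : ℕ) : Stage.{u} S L where
  F := (p.sig.ext (p.vars k)).F
  M := (p.sig.ext (p.vars k)).M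
  countable := p.countable.ext (p.vars k)
  T := (p.consistent.exists_witnessed (p.queue k.unpair.1 k.unpair.2)).choose_spec.choose
  consistent :=
    (p.consistent.exists_witnessed (p.queue k.unpair.1 k.unpair.2)).choose_spec.choose_spec.2.1
  queue := fun i j =>
    if i = k + 1 then (p.countable.ext (p.vars k)).exists_enumeration.choose j
    else (p.queue i j).wk (p.vars k)

/-- The weakening to the signature of the next stage. -/
noncomputable def wkNext (p : Stage.{u} S L) (k : ℕ) (φ : Sen p.sig) : Sen (p.next k).sig :=
  φ.wk (Sg := p.sig) (p.vars k)

theorem next_T (p : Stage.{u} S L) (k : ℕ) {φ : Sen p.sig} (hφ : φ ∈ p.T) :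
    p.wkNext k φ ∈ (p.next k).T :=
  (p.consistent.exists_witnessed (p.queue k.unpair.1 k.unpair.2)).choose_spec.choose_spec.1
    ⟨φ, hφ, rfl⟩

theorem next_witnessed (p : Stage.{u} S L) (k : ℕ) :
    .neg (p.wkNext k (p.queue k.unpair.1 k.unpair.2)) ∈ (p.next k).T ∨
      Witnessed (p.next k).T (p.wkNext k (p.queue k.unpair.1 k.unpair.2)) :=
  (p.consistent.exists_witnessed (p.queue k.unpair.1 k.unpair.2)).choose_spec.choose_spec.2.2

/-- The sequence of stages starting with a given one. -/
noncomputable def iter (p : Stage.{u} S L) : ℕ → Stage.{u} S L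
  | 0 => p
  | k + 1 => (p.iter k).next k

/-- The signatures of the stages. -/
noncomputable abbrev sigChain (p : Stage.{u} S L) : SigChain.{u} S L where
  F := fun k => (p.iter k).F
  M := fun k => (p.iter k).M
  inc := fun k {_ _ _} f => ExtOp.old (Sg := (p.iter k).sig) (X := (p.iter k).vars k) f
  inc_mono := fun _ {_ _ _} f hf => ⟨f, hf, rfl⟩

theorem up_queue (p : Stage.{u} S L) {k m : ℕ} (h : k ≤ m) (j : ℕ) :
    p.sigChain.up h ((p.iter k).queue k j) = (p.iter m).queue k j := by
  induction h with
  | refl => exact SigChain.up_self _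
  | @step m h ih =>
    rw [SigChain.up_succ h, ih]
    -- As `k ≤ m`, the queue at index `k` is weakened, not replaced, in passing to stage `m + 1`.
    have hk : k ≠ m + 1 := fun e => absurd h (by simp [e])
    exact (if_neg hk).symm

theorem queue_surjective (p : Stage.{u} S L) (hp : Function.Surjective (p.queue 0)) (k : ℕ) :
    Function.Surjective ((p.iter k).queue k) := by
  cases k with
  | zero => exact hp
  | succ k =>
    have h := ((p.iter k).countable.ext ((p.iter k).vars k)).exists_enumeration.choose_spec
    intro φ
    obtain ⟨j, hj⟩ := h φ
    exact ⟨j, (if_pos rfl).trans hj⟩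

/-- The Henkin chain of the theories of the stages. -/
noncomputable def chain (p : Stage.{u} S L) (hp : Function.Surjective (p.queue 0)) :
    HenkinChain.{u} S L where
  toSigChain := p.sigChain
  T := fun k => (p.iter k).T
  consistent := fun k => (p.iter k).consistent
  translate_mem := fun {k} φ hφ => (p.iter k).next_T k hφ
  witnessed := fun {k} φ => by
    obtain ⟨j, rfl⟩ := p.queue_surjective hp k φ
    -- The sentence is treated at stage `Nat.pair k j`, which is not before stage `k`.
    have hk : k ≤ Nat.pair k j := Nat.left_le_pair k j
    refine ⟨Nat.pair k j + 1, hk.trans (Nat.le_succ _), ?_⟩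
    have h := (p.iter (Nat.pair k j)).next_witnessed (Nat.pair k j)
    rw [Nat.unpair_pair, ← p.up_queue hk j] at h
    rw [SigChain.up_succ hk]
    exact h

end Stage

namespace HenkinChain

variable {S L : Type u} {C : HenkinChain.{u} S L} {k m : ℕ}

/-! ### Truth along a Henkin chain -/

/-- A sentence over the `k`-th signature holds if it is entailed by the theory of a later stage. -/
def Holds (C : HenkinChain.{u} S L) {k : ℕ} (φ : Sen (C.sig k)) : Prop :=
  ∃ (m : ℕ) (h : k ≤ m), Entails (C.sig m) (C.T m) {C.up h φ}

theorem up_mem (h : k ≤ m) {φ : Sen (C.sig k)} (hφ : φ ∈ C.T k) : C.up h φ ∈ C.T m := by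
  induction h with
  | refl => rwa [SigChain.up_self]
  | step h ih => rw [SigChain.up_succ h]; exact C.translate_mem ih

theorem entails_up (h : k ≤ m) {φ : Sen (C.sig k)} (hφ : Entails (C.sig k) (C.T k) {φ}) :
    Entails (C.sig m) (C.T m) {C.up h φ} := by
  have := SigChain.entails_up h hφ
  rw [Set.image_singleton] at this
  refine this.weaken ?_
  rintro _ ⟨γ, hγ, rfl⟩
  exact up_mem h hγ

theorem holds_up_iff (h : k ≤ m) {φ : Sen (C.sig k)} : C.Holds (C.up h φ) ↔ C.Holds φ := by
  constructor
  · rintro ⟨m', h', hφ⟩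
    exact ⟨m', h.trans h', by rwa [SigChain.up_up] at hφ⟩
  · rintro ⟨m', h', hφ⟩
    refine ⟨max m m', le_max_left _ _, ?_⟩
    have := entails_up (le_max_right m m') hφ
    rw [SigChain.up_up] at this ⊢
    exact this

theorem holds_of_mem {φ : Sen (C.sig k)} (h : φ ∈ C.T k) : C.Holds φ :=
  ⟨k, le_rfl, by rw [SigChain.up_self]; exact .of_mem h⟩

/-- The sentences that hold are closed under entailment from finitely many premises: these hold
together at a common stage. -/
theorem Holds.of_entails {Δ : Set (Sen (C.sig k))} (hΔ : Δ.Finite) {φ : Sen (C.sig k)}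
    (hφ : Entails (C.sig k) Δ {φ}) (h : ∀ δ ∈ Δ, C.Holds δ) : C.Holds φ := by
  have key : ∃ (m : ℕ) (hm : k ≤ m), ∀ δ ∈ Δ, Entails (C.sig m) (C.T m) {C.up hm δ} := by
    clear hφ
    induction Δ, hΔ using Set.Finite.induction_on with
    | empty => exact ⟨k, le_rfl, by simp⟩
    | @insert δ Δ _ _ ih =>
      obtain ⟨m, hm, hΔ⟩ := ih fun δ hδ => h δ (.inr hδ)
      obtain ⟨m', hm', hδ⟩ := h δ (.inl rfl)
      refine ⟨max m m', hm.trans (le_max_left _ _), ?_⟩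
      rintro γ (rfl | hγ)
      · simpa only [SigChain.up_up] using entails_up (le_max_right m m') hδ
      · simpa only [SigChain.up_up] using entails_up (le_max_left m m') (hΔ γ hγ)
  obtain ⟨m, hm, hΔ⟩ := key
  refine ⟨m, hm, .transitivity (.union ?_) (by simpa using SigChain.entails_up hm hφ)⟩
  rintro _ ⟨δ, hδ, rfl⟩
  exact hΔ δ hδ

theorem Holds.of_entails_one {δ φ : Sen (C.sig k)} (h : C.Holds δ)
    (hφ : Entails (C.sig k) {δ} {φ}) : C.Holds φ :=
  .of_entails (Set.finite_singleton δ) hφ (by rintro _ rfl; exact h)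

theorem Holds.of_entails_two {δ δ' φ : Sen (C.sig k)} (h : C.Holds δ) (h' : C.Holds δ')
    (hφ : Entails (C.sig k) {δ, δ'} {φ}) : C.Holds φ :=
  .of_entails (Set.toFinite {δ, δ'}) hφ (by rintro _ (rfl | rfl); exacts [h, h'])

theorem not_holds_bot : ¬ C.Holds (Sen.bot : Sen (C.sig k)) := by
  rintro ⟨m, h, hb⟩
  rw [SigChain.up_bot] at hb
  exact C.consistent m hb

theorem Holds.witnessed {φ : Sen (C.sig k)} (hφ : C.Holds φ) :
    ∃ (m : ℕ) (h : k ≤ m), Witnessed (C.T m) (C.up h φ) := by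
  obtain ⟨m, h, hm | hm⟩ := C.witnessed φ
  · refine absurd ?_ (not_holds_bot (C := C) (k := m))
    exact ((holds_up_iff h).2 hφ).of_entails_two (holds_of_mem hm)
      (.bot_of_neg (.of_mem (.inl rfl)) (.of_mem (.inr rfl)))
  · exact ⟨m, h, hm⟩

theorem holds_neg_iff {φ : Sen (C.sig k)} : C.Holds φ.neg ↔ ¬ C.Holds φ := by
  constructor
  · intro h h'
    exact not_holds_bot (h'.of_entails_two h
      (.bot_of_neg (.of_mem (.inl rfl)) (.of_mem (.inr rfl))))
  · intro h
    obtain ⟨m, hm, h' | h'⟩ := C.witnessed φ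
    · rw [← SigChain.up_neg] at h'
      exact (holds_up_iff hm).1 (holds_of_mem h')
    · exact absurd ⟨m, hm, h'.entails⟩ h

theorem holds_eq_refl {s : S} (t : Term (C.sig k) s) : C.Holds (.eq t t) :=
  .of_entails Set.finite_empty (.refl t) (by simp)

theorem Holds.eq_symm {s : S} {t u : Term (C.sig k) s} (h : C.Holds (.eq t u)) :
    C.Holds (.eq u t) :=
  h.of_entails_one (.symm (.of_mem rfl))

theorem Holds.eq_trans {s : S} {t u v : Term (C.sig k) s} (h : C.Holds (.eq t u))
    (h' : C.Holds (.eq u v)) : C.Holds (.eq t v) :=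
  h.of_entails_two h' (.eqTrans (.of_mem (.inl rfl)) (.of_mem (.inr rfl)))

theorem Holds.predCongr {l : L} {s : S} {t u t' u' : Term (C.sig k) s} (ht : C.Holds (.eq t t'))
    (hu : C.Holds (.eq u u')) (h : C.Holds (.trans (Sg := C.sig k) (.lab l) t u)) :
    C.Holds (.trans (Sg := C.sig k) (.lab l) t' u') := by
  refine .of_entails (Set.toFinite {.eq t t', .eq u u', .trans (Sg := C.sig k) (.lab l) t u})
    (.predCongr (Sg := C.sig k) l (.of_mem (.inl rfl)) (.of_mem (.inr (.inl rfl)))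
      (.of_mem (.inr (.inr rfl)))) ?_
  rintro _ (rfl | rfl | rfl)
  exacts [ht, hu, h]

theorem holds_eq_up_iff (h : k ≤ m) {s : S} {t u : Term (C.sig k) s} :
    C.Holds (.eq (Sg := C.sig m) (C.upTerm h t) (C.upTerm h u)) ↔ C.Holds (.eq t u) := by
  rw [← SigChain.up_eq, holds_up_iff]

/-! ### The model of a Henkin chain -/

/-- Terms over two stages are identified if their equation holds over some later stage. -/
def termSetoid (C : HenkinChain.{u} S L) (s : S) : Setoid (Σ k : ℕ, Term (C.sig k) s) where
  r p q := ∃ (m : ℕ) (h : p.1 ≤ m) (h' : q.1 ≤ m),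
    C.Holds (.eq (Sg := C.sig m) (C.upTerm h p.2) (C.upTerm h' q.2))
  iseqv :=
    { refl := fun p => ⟨p.1, le_rfl, le_rfl, holds_eq_refl _⟩
      symm := fun ⟨m, h, h', e⟩ => ⟨m, h', h, e.eq_symm⟩
      trans := by
        rintro p q r ⟨m, h₁, h₂, e⟩ ⟨m', h₂', h₃, e'⟩
        refine ⟨max m m', h₁.trans (le_max_left _ _), h₃.trans (le_max_right _ _), ?_⟩
        have e := (holds_eq_up_iff (le_max_left m m')).2 e
        have e' := (holds_eq_up_iff (le_max_right m m')).2 e'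
        simp only [SigChain.upTerm_upTerm] at e e'
        exact e.eq_trans e' }

/-- The elements of the model: the terms over all stages, up to equality. -/
def Carrier (C : HenkinChain.{u} S L) (s : S) : Type u := Quotient (C.termSetoid s)

/-- The element denoted by a term. -/
def cls {s : S} (t : Term (C.sig k) s) : C.Carrier s := Quotient.mk (C.termSetoid s) ⟨k, t⟩

theorem cls_eq_iff {s : S} {t u : Term (C.sig k) s} :
    cls t = cls u ↔ C.Holds (.eq t u) := by
  refine Quotient.eq.trans ⟨?_, fun h => ⟨k, le_rfl, le_rfl, ?_⟩⟩
  · rintro ⟨m, h, h', e⟩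
    exact (holds_eq_up_iff h).1 e
  · simpa only [SigChain.upTerm_self] using h

theorem cls_upTerm (h : k ≤ m) {s : S} (t : Term (C.sig k) s) :
    cls (C := C) (C.upTerm h t) = cls t := by
  refine Quotient.eq.2 ⟨m, le_rfl, h, ?_⟩
  rw [SigChain.upTerm_self]
  exact holds_eq_refl _

/-- Finitely many elements are denoted by terms over a common stage. -/
theorem exists_rep {ι : Type*} [Finite ι] {w : ι → S} (as : (i : ι) → C.Carrier (w i)) (k : ℕ) :
    ∃ (m : ℕ) (_ : k ≤ m) (ts : (i : ι) → Term (C.sig m) (w i)), as = fun i => cls (ts i) := by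
  have h (i : ι) : ∃ p : Σ k : ℕ, Term (C.sig k) (w i), cls p.2 = as i :=
    Quotient.exists_rep (as i)
  choose p hp using h
  obtain ⟨m, hm⟩ := (Set.finite_range fun i => (p i).1).bddAbove
  have hm (i : ι) : (p i).1 ≤ max k m := (hm ⟨i, rfl⟩).trans (le_max_right _ _)
  refine ⟨max k m, le_max_left _ _, fun i => C.upTerm (hm i) (p i).2, ?_⟩
  funext i
  rw [cls_upTerm, hp]

theorem exists_rep_one {s : S} (a : C.Carrier s) (k : ℕ) :
    ∃ (m : ℕ) (_ : k ≤ m) (t : Term (C.sig m) s), a = cls t := by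
  obtain ⟨m, h, ts, e⟩ := exists_rep (ι := Unit) (w := fun _ => s) (fun _ => a) k
  exact ⟨m, h, ts (), congrFun e ()⟩

/-- The interpretation of a symbol over the `k`-th signature: the symbol is applied to terms over
a common stage which denote the arguments. By `opCls_cls` the choice of these terms is
immaterial. -/
noncomputable def opCls {n : ℕ} {w : Fin n → S} {s : S} (f : C.F k n w s)
    (as : (i : Fin n) → C.Carrier (w i)) : C.Carrier s :=
  cls (.app (Sg := C.sig (exists_rep as k).choose)
    (C.upOp (exists_rep as k).choose_spec.choose f)
    (exists_rep as k).choose_spec.choose_spec.choose)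

theorem cls_app_congr {n : ℕ} {w : Fin n → S} {s : S} (f : C.F k n w s)
    {ts us : (i : Fin n) → Term (C.sig k) (w i)}
    (h : ∀ i, cls (C := C) (ts i) = cls (us i)) :
    cls (C := C) (.app (Sg := C.sig k) f ts) = cls (.app (Sg := C.sig k) f us) := by
  refine cls_eq_iff.2 (.of_entails (Set.finite_range fun i => Sen.eq (ts i) (us i))
    (.congr (Sg := C.sig k) f fun i => .of_mem ⟨i, rfl⟩) ?_)
  rintro _ ⟨i, rfl⟩
  exact cls_eq_iff.1 (h i)

theorem opCls_cls {n : ℕ} {w : Fin n → S} {s : S} (h : k ≤ m) (f : C.F k n w s)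
    (ts : (i : Fin n) → Term (C.sig m) (w i)) :
    opCls f (fun i => cls (ts i)) = cls (.app (Sg := C.sig m) (C.upOp h f) ts) := by
  have hr := exists_rep (C := C) (fun i => cls (ts i)) k
  obtain ⟨h', e⟩ : ∃ h' : k ≤ hr.choose, _ = _ :=
    ⟨hr.choose_spec.choose, hr.choose_spec.choose_spec.choose_spec⟩
  have e := congrFun e
  change cls (.app (Sg := C.sig hr.choose) (C.upOp h' f)
    hr.choose_spec.choose_spec.choose) = _
  rw [← cls_upTerm (C := C) (le_max_left hr.choose m),
    ← cls_upTerm (C := C) (le_max_right hr.choose m),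
    SigChain.upTerm_app, SigChain.upTerm_app, SigChain.upOp_upOp, SigChain.upOp_upOp]
  refine cls_app_congr _ fun i => ?_
  rw [cls_upTerm, cls_upTerm, e]

/-- The interpretation of a label: the transition holds between some terms denoting the two
elements. By `relCls_cls_iff` it then holds between any such terms over a common stage. -/
def relCls (C : HenkinChain.{u} S L) (l : L) (s : S) (a b : C.Carrier s) : Prop :=
  ∃ (m : ℕ) (t u : Term (C.sig m) s), cls t = a ∧ cls u = b ∧
    C.Holds (.trans (Sg := C.sig m) (.lab l) t u)

theorem holds_trans_up_iff (h : k ≤ m) {s : S} {a : Action L} {t u : Term (C.sig k) s} :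
    C.Holds (.trans (Sg := C.sig m) a (C.upTerm h t) (C.upTerm h u)) ↔
      C.Holds (.trans (Sg := C.sig k) a t u) := by
  rw [← SigChain.up_trans, holds_up_iff]

theorem relCls_cls_iff {l : L} {s : S} {t u : Term (C.sig k) s} :
    C.relCls l s (cls t) (cls u) ↔ C.Holds (.trans (Sg := C.sig k) (.lab l) t u) := by
  refine ⟨?_, fun h => ⟨k, t, u, rfl, rfl, h⟩⟩
  rintro ⟨m, t', u', ht, hu, h⟩
  rw [← cls_upTerm (le_max_left m k), ← cls_upTerm (le_max_right m k), cls_eq_iff] at ht hu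
  rw [← holds_trans_up_iff (le_max_left m k)] at h
  rw [← holds_trans_up_iff (le_max_right m k)]
  exact ht.predCongr hu h

/-- The model of the `k`-th signature. All these models have the same elements and relations. -/
noncomputable def model (C : HenkinChain.{u} S L) (k : ℕ) : Model (C.sig k) where
  carrier := C.Carrier
  op := fun f as => opCls f as
  rel := C.relCls
  monotone := by
    intro n w s f hf l as j b h
    obtain ⟨m, hm, ts, rfl⟩ := exists_rep as k
    obtain ⟨m', hm', v, rfl⟩ := exists_rep_one b m
    have e : (fun i => cls (C := C) (ts i)) = fun i => cls (C.upTerm hm' (ts i)) := by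
      funext i
      rw [cls_upTerm]
    have e' : Function.update (fun i => cls (C := C) (ts i)) j (cls v) =
        fun i => cls (Function.update (fun i => C.upTerm hm' (ts i)) j v i) := by
      rw [e]
      funext i
      rw [Function.apply_update (fun i => cls (C := C))]
    rw [e', e, opCls_cls (hm.trans hm'), opCls_cls (hm.trans hm'), relCls_cls_iff]
    refine Holds.of_entails_one (relCls_cls_iff.1 (?_ : C.relCls l (w j)
      (cls (C.upTerm hm' (ts j))) (cls v))) ?_
    · rwa [cls_upTerm]
    · exact .mono (Sg := C.sig m') _ (SigChain.upOp_mono _ hf) l _ j v (.of_mem rfl)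

theorem eval_model {s : (C.sig k).S} (t : Term (C.sig k) s) : (C.model k).eval t = cls t := by
  induction t with
  | app f ts ih =>
    simp only [Model.eval, ih]
    change opCls f _ = _
    rw [opCls_cls le_rfl, SigChain.upOp_self]

theorem opCls_inc {n : ℕ} {w : Fin n → S} {s : S} (f : C.F k n w s)
    (as : (i : Fin n) → C.Carrier (w i)) : opCls (C.inc k f) as = opCls f as := by
  obtain ⟨m, hm, ts, rfl⟩ := exists_rep as (k + 1)
  rw [opCls_cls hm, opCls_cls (k.le_succ.trans hm), ← SigChain.upOp_upOp k.le_succ hm,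
    SigChain.upOp_succ le_rfl, SigChain.upOp_self]

/-- The expansions of consecutive models agree on the smaller signature. -/
theorem reduct_model_succ (C : HenkinChain.{u} S L) (k : ℕ) (X : VarSet S)
    (g : (x : {i : ℕ // i ∈ X.names}) → C.Carrier (X.sort x)) :
    ((C.model (k + 1)).expand (X := X) g).reduct ((C.hom k).toRepl.lift X)
      (Repl.Monotone.lift (Hom.toRepl_monotone (C.hom k)) X) = (C.model k).expand (X := X) g := by
  refine (Model.reduct_expand (C.model (k + 1)) (C.hom k).toRepl
    (Hom.toRepl_monotone (C.hom k)) X g).trans ?_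
  refine Model.ext_op rfl (heq_of_eq ?_) HEq.rfl
  funext n (w : Fin n → (C.sig k).S) (s : (C.sig k).S) (f : ExtOp (C.sig k) X n w s) as
  cases f with
  | old f => exact opCls_inc f as
  | var w x => rfl

theorem sat_upBody (h : k ≤ m) {X : VarSet S}
    (g : (x : {i : ℕ // i ∈ X.names}) → C.Carrier (X.sort x)) (φ : Sen ((C.sig k).ext X)) :
    Sat ((C.model m).expand (X := X) g) (C.upBody h X φ) ↔
      Sat ((C.model k).expand (X := X) g) φ := by
  induction h with
  | refl => rw [SigChain.upBody_self]
  | @step m h ih =>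
    rw [SigChain.upBody_succ h, ← ih]
    refine (sat_map _ _ (Repl.Monotone.lift (Hom.toRepl_monotone (C.hom m)) X) _).trans ?_
    exact iff_of_eq (congrArg (fun A => Sat A (C.upBody h X φ)) (reduct_model_succ C m X g))

/-! ### The truth lemma -/

theorem holds_comp_iff {s : S} {a b : Action L} {t u : Term (C.sig k) s} :
    C.Holds (.trans (Sg := C.sig k) (.comp a b) t u) ↔
      ∃ (m : ℕ) (h : k ≤ m) (v : Term (C.sig m) s),
        C.Holds (.trans (Sg := C.sig m) a (C.upTerm h t) v) ∧
        C.Holds (.trans (Sg := C.sig m) b v (C.upTerm h u)) := by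
  constructor
  · intro h
    obtain ⟨m, hm, hw⟩ := h.witnessed
    rw [SigChain.up_trans] at hw
    obtain ⟨v, h₁, h₂⟩ := hw
    exact ⟨m, hm, v, holds_of_mem h₁, holds_of_mem h₂⟩
  · rintro ⟨m, hm, v, h₁, h₂⟩
    rw [← holds_trans_up_iff hm]
    exact h₁.of_entails_two h₂ (.compI (.of_mem (.inl rfl)) (.of_mem (.inr rfl)))

theorem holds_union_iff {s : S} {a b : Action L} {t u : Term (C.sig k) s} :
    C.Holds (.trans (Sg := C.sig k) (.union a b) t u) ↔
      C.Holds (.trans (Sg := C.sig k) a t u) ∨ C.Holds (.trans (Sg := C.sig k) b t u) := by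
  constructor
  · intro h
    obtain ⟨m, hm, hw⟩ := h.witnessed
    rw [SigChain.up_trans] at hw
    simp only [← holds_trans_up_iff hm]
    exact hw.imp holds_of_mem holds_of_mem
  · rintro (h | h)
    exacts [h.of_entails_one (.unionI₁ (.of_mem rfl)), h.of_entails_one (.unionI₂ (.of_mem rfl))]

theorem holds_star_iff {s : S} {a : Action L} {t u : Term (C.sig k) s} :
    C.Holds (.trans (Sg := C.sig k) (.star a) t u) ↔
      ∃ n, C.Holds (.transPow (Sg := C.sig k) a n t u) := by
  constructor
  · intro h
    obtain ⟨m, hm, hw⟩ := h.witnessed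
    rw [SigChain.up_trans] at hw
    obtain ⟨n, hn⟩ := hw
    rw [← SigChain.up_transPow] at hn
    exact ⟨n, (holds_up_iff hm).1 (holds_of_mem hn)⟩
  · rintro ⟨n, h⟩
    exact h.of_entails_one (.starI n (.of_mem rfl))

theorem act_comp_cls_iff (k₀ : ℕ) {s : S} {a b : Action L}
    (ha : ∀ {k : ℕ} {t u : Term (C.sig k) s},
      (C.model k₀).act a s (cls t) (cls u) ↔ C.Holds (.trans (Sg := C.sig k) a t u))
    (hb : ∀ {k : ℕ} {t u : Term (C.sig k) s},
      (C.model k₀).act b s (cls t) (cls u) ↔ C.Holds (.trans (Sg := C.sig k) b t u))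
    {k : ℕ} {t u : Term (C.sig k) s} :
    (C.model k₀).act (.comp a b) s (cls t) (cls u) ↔
      C.Holds (.trans (Sg := C.sig k) (.comp a b) t u) := by
  rw [holds_comp_iff]
  constructor
  · rintro ⟨c, h₁, h₂⟩
    obtain ⟨m, hm, v, rfl⟩ := exists_rep_one c k
    rw [← cls_upTerm hm] at h₁ h₂
    exact ⟨m, hm, v, ha.1 h₁, hb.1 h₂⟩
  · rintro ⟨m, hm, v, h₁, h₂⟩
    have h₁ := ha.2 h₁
    have h₂ := hb.2 h₂
    rw [cls_upTerm] at h₁ h₂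
    exact ⟨_, h₁, h₂⟩

theorem act_cls_iff (k₀ : ℕ) {s : S} (a : Action L) {k : ℕ} {t u : Term (C.sig k) s} :
    (C.model k₀).act a s (cls t) (cls u) ↔ C.Holds (.trans (Sg := C.sig k) a t u) := by
  induction a generalizing k with
  | lab l => exact relCls_cls_iff
  | comp a b iha ihb => exact act_comp_cls_iff k₀ iha ihb
  | union a b iha ihb =>
    rw [holds_union_iff, ← iha, ← ihb]
    rfl
  | star a ih =>
    -- Each power of `a` is a composition, so that the argument for compositions applies to it.
    have pow (n : ℕ) {k : ℕ} {t u : Term (C.sig k) s} :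
        (C.model k₀).act (a.succPow n) s (cls t) (cls u) ↔
          C.Holds (.trans (Sg := C.sig k) (a.succPow n) t u) := by
      induction n generalizing k with
      | zero => exact ih
      | succ n ihn => exact act_comp_cls_iff k₀ ih ihn
    rw [holds_star_iff]
    constructor
    · intro h
      rcases (C.model k₀).exists_transPow h with h | ⟨n, h⟩
      · exact ⟨0, cls_eq_iff.1 h⟩
      · exact ⟨n + 1, (pow n).1 h⟩
    · rintro ⟨_ | n, h⟩
      · change Relation.ReflTransGen _ _ _
        rw [cls_eq_iff.2 h]
        exact .refl
      · exact (C.model k₀).act_succPow_reflTransGen a s n ((pow n).2 h)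

/-- The truth lemma: satisfaction in the model is entailment by the theories of the chain. -/
theorem sat_model_iff (φ : Sen (C.sig k)) : Sat (C.model k) φ ↔ C.Holds φ := by
  induction hd : φ.depth using Nat.strong_induction_on generalizing k with
  | _ d IH =>
    subst hd
    cases φ with
    | eq t u =>
      simp only [Sat, eval_model]
      exact cls_eq_iff
    | trans a t u =>
      simp only [Sat, eval_model]
      exact act_cls_iff k a
    | neg φ =>
      rw [holds_neg_iff, ← IH _ (Nat.lt_succ_self _) φ rfl]
      rfl
    | disj Φ =>
      have ih i : Sat (C.model k) (Φ i) ↔ C.Holds (Φ i) :=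
        IH _ (Nat.lt_succ_of_le (Finset.le_sup (f := fun i => (Φ i).depth) (Finset.mem_univ i)))
          _ rfl
      simp only [Sat, ih]
      constructor
      · rintro ⟨i, h⟩
        exact h.of_entails_one (.disjI i (.of_mem rfl))
      · intro h
        obtain ⟨m, hm, hw⟩ := h.witnessed
        rw [SigChain.up_disj] at hw
        obtain ⟨i, hi⟩ := hw
        exact ⟨i, (holds_up_iff hm).1 (holds_of_mem hi)⟩
    | ex X φ =>
      -- A valuation of `X` has finitely many values, so it is given by terms over one stage.
      have key {m : ℕ} (h : k ≤ m) (θ : (x : {i : ℕ // i ∈ X.names}) → Term (C.sig m) (X.sort x)) :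
          Sat ((C.model k).expand (X := X) fun x => cls (θ x)) φ ↔
            C.Holds ((C.upBody h X φ).subst (Sg := C.sig m) θ) := by
        have hd : ((C.upBody h X φ).subst (Sg := C.sig m) θ).depth < (Sen.ex X φ).depth := by
          -- Instances of the body have its depth, however deep the substituted terms are.
          rw [Sen.subst, Sen.depth_map, SigChain.depth_upBody]
          exact Nat.lt_succ_self _
        rw [← IH _ hd _ rfl, sat_subst, ← sat_upBody h]
        simp only [eval_model]
      simp only [Sat]
      constructor
      · rintro ⟨g, hg⟩
        obtain ⟨m, hm, θ, rfl⟩ := exists_rep g k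
        rw [← holds_up_iff hm, SigChain.up_ex]
        exact ((key hm θ).1 hg).of_entails_one (.subst θ (.of_mem rfl))
      · intro h
        obtain ⟨m, hm, hw⟩ := h.witnessed
        rw [SigChain.up_ex] at hw
        obtain ⟨θ, hθ⟩ := hw
        exact ⟨_, (key hm θ).2 (holds_of_mem hθ)⟩

end HenkinChain

/-! ### Completeness -/

/-- Over a countable signature, every consistent theory has a model. -/
theorem Consistent.exists_model {Sg : Signature.{u}} (hSg : Sg.IsCountable) {T : Set (Sen Sg)}
    (hT : Consistent T) : ∃ A : Model Sg, ∀ γ ∈ T, Sat A γ := by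
  obtain ⟨e, he⟩ := hSg.exists_enumeration
  let p : Stage.{u} Sg.S Sg.L := ⟨Sg.F, Sg.M, hSg, T, hT, fun _ => e⟩
  let C := p.chain he
  exact ⟨C.model 0, fun γ hγ => (C.sat_model_iff (k := 0) γ).2 (C.holds_of_mem (k := 0) hγ)⟩

end TA

theorem mainTheorem1 (Sg : TA.Signature.{u}) (hSg : Sg.IsCountable)
    (Γ : Set (TA.Sen Sg)) (φ : TA.Sen Sg) :
    TA.Entails Sg Γ {φ} ↔ TA.SemEntails Sg Γ {φ} := by
  refine ⟨TA.Entails.sound, fun h => ?_⟩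
  by_contra hΓ
  -- Otherwise `Γ ∪ {¬φ}` is consistent, by double negation elimination.
  have hT : TA.Consistent (Γ ∪ {φ.neg}) := fun hb => hΓ (.negD (.negI hb))
  obtain ⟨A, hA⟩ := hT.exists_model hSg
  exact hA φ.neg (.inr rfl) (h A (fun γ hγ => hA γ (.inl hγ)) φ rfl)
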